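/- Let $n\ge 0$ and let $\mathrm{TL}^D_{n+1}$ be the Temperley--Lieb algebra of type $D_{n+1}$ over $\mathbb{C}(q)$. It has generators $E_0,\dots,E_n$ and relations $E_i^2=-[2]E_i$; $E_iE_jE_i=E_i$ if $i,j$ are adjacent; $E_iE_j=E_jE_i$ if $i,j$ are not adjacent. Here $[2]=q+q^{-1}$ and the edges of the Dynkin diagram are $0-2$ and $k-(k+1)$ for $k\ge1$. For $i\le n$ regard $\mathrm{TL}^D_{i+1}$ as mapped to $\mathrm{TL}^D_{n+1}$ by $E_j\mapsto E_j$. Let $Q_n\in \mathrm{TL}^D_{n+1}$, $n\ge0$, be the Jones--Wenzl projections of type $D$, that is, $Q_n\ne0$, $Q_nQ_i=Q_iQ_n=Q_n$ for $0\le i\le n$, and $E_iQ_n=Q_nE_i=0$ for $0\le i\le n$. A word $E_w=E_{s_1}\cdots E_{s_l}$ is a reduced expression if it is not a scalar multiple of a product of fewer than $l$ generators. Then $Q_n$ has a unique expansion as a linear combination of the elements of $\mathrm{TL}^D_{n+1}$ given by reduced expressions; write $\mathrm{coef}^n(x)$ for the coefficient of $x$ in it. The following hold. 1. If $E_w=E_{s_1}\cdots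 E_{s_l}$ is a reduced expression, then so is $\overline{E_w}=E_{s_l}\cdots E_{s_1}$, and $\mathrm{coef}^n(E_w)=\mathrm{coef}^n(\overline{E_w})$. 2. Let $n\ge1$. An $(n+1)$-strand diagram of type $D$ is a planar matching of $n+1$ top and $n+1$ bottom points by arcs, each carrying at most one dot, such that the number of dots is one or even; if it is even, every dot is on an outer-most cup (an arc joining two top points, with no larger cup around it and no vertical strand to its left), an outer-most cap (likewise on the bottom) or the left-most vertical strand; if it is one, the dot is on the arc at the left-most bottom point; and the diagram of $n+1$ vertical strands has no dot. The generator $E_i$, $i\ge1$, has the diagram with a cup and a cap joining the points $i,i+1$ and all other strands vertical, without dots; $E_0$ has the arcs of $E_1$ with a dot on its cup and on its cap. The diagram of a reduced word is obtained by stacking those of its letters from top to bottom, deleting loops, and, if the number of dots left is odd, replacing them by one dot on the arc at the left-most bottom point. The upside-down diagram $\overline D$ of a diagram $D$ is its reflection in a horizontal line, where a unique dot is moved to the arc at the left-most bottom point. Then, for each reduced expression $E_w$, the diagram of $\overline{E_w}$ is the upside-down diagram of that of $E_w$; and for every diagram $D$ of type $D$, $\overline D$ is again a diagram of type $D$, and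 the coefficient of $D$ in $Q_n$ (where each reduced word in the expansion of $Q_n$ is replaced by its diagram) equals the coefficient of $\overline D$. 3. Let $n\ge1$. For every word $E_w$ in $E_0,\dots,E_n$ let $\theta(E_w)$ be the word obtained by replacing every $E_0$ by $E_1$ and every $E_1$ by $E_0$. If $E_w$ is a reduced expression, then so is $\theta(E_w)$; and $\mathrm{coef}^n(E_w)=\mathrm{coef}^n(\theta(E_w))$, where $\mathrm{coef}^n(x)=0$ if $x$ is not given by a reduced expression. -/

import Mathlib

namespace TLD

/-- The ground field `ℂ(q)`. -/
abbrev K : Type := RatFunc ℂ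

noncomputable section

/-- The indeterminate `q`. -/
def q : K := RatFunc.X

/-- The `q`-integer `[m] = (q^m - q^{-m}) / (q - q^{-1})`. -/
def qInt (m : ℕ) : K := (q ^ m - q⁻¹ ^ m) / (q - q⁻¹)

end

/-! ### The Temperley-Lieb algebra of type `D` of rank `n + 1` -/

/-- Adjacency of the nodes `i`, `j` in the Dynkin diagram `D_{n+1}`, whose nodes are `0, 1, …, n`
and whose edges are `0 - 2` and `k - (k+1)` for `k ≥ 1`. -/
def Adjacent (i j : ℕ) : Prop :=
  (i = 0 ∧ j = 2) ∨ (i = 2 ∧ j = 0) ∨ (1 ≤ i ∧ j = i + 1) ∨ (1 ≤ j ∧ i = j + 1)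

/-- The defining relations in the free algebra on `E_0, …, E_n`. -/
inductive Rel (n : ℕ) :
    FreeAlgebra K (Fin (n + 1)) → FreeAlgebra K (Fin (n + 1)) → Prop
  | sq (i : Fin (n + 1)) :
      Rel n (FreeAlgebra.ι K i * FreeAlgebra.ι K i) (-qInt 2 • FreeAlgebra.ι K i)
  | braid (i j : Fin (n + 1)) (h : Adjacent i.val j.val) :
      Rel n (FreeAlgebra.ι K i * FreeAlgebra.ι K j * FreeAlgebra.ι K i) (FreeAlgebra.ι K i)
  | comm (i j : Fin (n + 1)) (h : ¬ Adjacent i.val j.val) :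
      Rel n (FreeAlgebra.ι K i * FreeAlgebra.ι K j) (FreeAlgebra.ι K j * FreeAlgebra.ι K i)

/-- `TL n` is the Temperley-Lieb algebra of type `D_{n+1}`, generated by `E_0, …, E_n`. -/
def TL (n : ℕ) : Type := RingQuot (Rel n)

noncomputable section

instance (n : ℕ) : Ring (TL n) := inferInstanceAs (Ring (RingQuot (Rel n)))

instance (n : ℕ) : Algebra K (TL n) := inferInstanceAs (Algebra K (RingQuot (Rel n)))

/-- The quotient map from the free algebra. -/
def mk (n : ℕ) : FreeAlgebra K (Fin (n + 1)) →ₐ[K] TL n := RingQuot.mkAlgHom K (Rel n)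

/-- The generator `E_i`. -/
def E {n : ℕ} (i : Fin (n + 1)) : TL n := mk n (FreeAlgebra.ι K i)

/-- The product `E_w = E_{s_1} ⋯ E_{s_l}` of the word `w = (s_1, …, s_l)`. -/
def word {n : ℕ} (w : List (Fin (n + 1))) : TL n := (w.map E).prod

theorem mk_rel {n : ℕ} {x y : FreeAlgebra K (Fin (n + 1))} (h : Rel n x y) : mk n x = mk n y :=
  RingQuot.mkAlgHom_rel K h

theorem E_sq {n : ℕ} (i : Fin (n + 1)) : E i * E i = -qInt 2 • E i := by
  have h := mk_rel (Rel.sq i)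
  rwa [map_mul, map_smul] at h

theorem E_braid {n : ℕ} (i j : Fin (n + 1)) (h : Adjacent i.val j.val) :
    E i * E j * E i = E i := by
  have h := mk_rel (Rel.braid i j h)
  rwa [map_mul, map_mul] at h

theorem E_comm {n : ℕ} (i j : Fin (n + 1)) (h : ¬ Adjacent i.val j.val) :
    E i * E j = E j * E i := by
  have h := mk_rel (Rel.comm i j h)
  rwa [map_mul, map_mul] at h

/-- For `m ≤ n`, the algebra map from rank `m + 1` to rank `n + 1` sending `E_i` to `E_i`. -/
def incl {m n : ℕ} (h : m ≤ n) : TL m →ₐ[K] TL n :=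
  RingQuot.liftAlgHom K
    ⟨FreeAlgebra.lift K (fun i : Fin (m + 1) => (E (Fin.castLE (by omega) i) : TL n)), by
      intro x y r
      cases r with
      | sq i => simpa using E_sq _
      | braid i j h => simpa using E_braid _ _ (by simpa using h)
      | comm i j h => simpa using E_comm _ _ (by simpa using h)⟩

theorem incl_E {m n : ℕ} (h : m ≤ n) (i : Fin (m + 1)) :
    incl h (E i) = E (Fin.castLE (by omega) i) :=
  (RingQuot.liftAlgHom_mkAlgHom_apply K _ _ _).trans (FreeAlgebra.lift_ι_apply _ _)

end

/-- `Q 0, Q 1, …` are the Jones-Wenzl projections of type `D`; here `Q n` lives in rank `n + 1`. -/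
structure IsJonesWenzl (Q : ∀ n : ℕ, TL n) : Prop where
  ne_zero : ∀ n, Q n ≠ 0
  absorb : ∀ i n (h : i ≤ n), Q n * incl h (Q i) = Q n ∧ incl h (Q i) * Q n = Q n
  kill : ∀ n (i : Fin (n + 1)), E i * Q n = 0 ∧ Q n * E i = 0

/-! ### Reduced expressions and coefficients -/

/-- The word `w` of length `l` is a reduced expression: `E_w` cannot be written, up to a scalar,
with fewer than `l` generators. -/
def IsReduced {n : ℕ} (w : List (Fin (n + 1))) : Prop :=
  ∀ (w' : List (Fin (n + 1))) (a : K), word w = a • word w' → w.length ≤ w'.length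

/-- `c` is an expansion of `x` as a linear combination of reduced words: `c b` is the coefficient
of the element `b`, and only elements given by reduced words occur. -/
structure IsExpansion {n : ℕ} (c : TL n →₀ K) (x : TL n) : Prop where
  reduced : ∀ b ∈ c.support, ∃ w, IsReduced w ∧ word w = b
  sum_eq : c.sum (fun b a => a • b) = x

/-- The exchange of the labels `0` and `1` (used for `n ≥ 1`). -/
def theta {n : ℕ} : Fin (n + 1) ≃ Fin (n + 1) := Equiv.swap 0 1

/-! ### Diagrams with dots on `n + 1` strands -/

/-- The marked points: `Sum.inl i` is the `(i+1)`-st point on the top, counted from the left, and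
`Sum.inr i` is the `(i+1)`-st point on the bottom. -/
abbrev Point (n : ℕ) : Type := Fin (n + 1) ⊕ Fin (n + 1)

/-- The data of a diagram: which pairs of distinct marked points are joined by an arc, and which
marked points lie on an arc that has a dot. -/
@[ext]
structure PreDiagram (n : ℕ) where
  joined : Point n → Point n → Prop
  dotted : Point n → Prop

/-- Position on the boundary, clockwise from the top left. -/
def pos {n : ℕ} : Point n → ℕ
  | Sum.inl i => i.val
  | Sum.inr i => 2 * n + 1 - i.val

namespace PreDiagram

variable {n : ℕ} (D : PreDiagram n)

/-- The number of dots, that is, of arcs with a dot. -/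
noncomputable def numDots : ℕ :=
  {a : Sym2 (Point n) | ∃ p p', a = s(p, p') ∧ D.joined p p' ∧ D.dotted p}.ncard

/-- The top points `i < j` are joined by an outer-most cup. -/
def OutermostCup (i j : Fin (n + 1)) : Prop :=
  i < j ∧ D.joined (Sum.inl i) (Sum.inl j) ∧
    (¬ ∃ a b, a < i ∧ j < b ∧ D.joined (Sum.inl a) (Sum.inl b)) ∧
    ¬ ∃ a b, a < i ∧ D.joined (Sum.inl a) (Sum.inr b)

/-- The bottom points `i < j` are joined by an outer-most cap. -/
def OutermostCap (i j : Fin (n + 1)) : Prop :=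
  i < j ∧ D.joined (Sum.inr i) (Sum.inr j) ∧
    (¬ ∃ a b, a < i ∧ j < b ∧ D.joined (Sum.inr a) (Sum.inr b)) ∧
    ¬ ∃ a b, a < i ∧ D.joined (Sum.inr a) (Sum.inl b)

/-- The top point `i` and the bottom point `j` are joined by the left-most vertical strand. -/
def LeftmostVertical (i j : Fin (n + 1)) : Prop :=
  D.joined (Sum.inl i) (Sum.inr j) ∧ ¬ ∃ a b, a < i ∧ D.joined (Sum.inl a) (Sum.inr b)

/-- The point `p` is on an outer-most cup, an outer-most cap or the left-most vertical strand. -/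
def Exposed (p : Point n) : Prop :=
  (∃ i j, D.OutermostCup i j ∧ (p = Sum.inl i ∨ p = Sum.inl j)) ∨
  (∃ i j, D.OutermostCap i j ∧ (p = Sum.inr i ∨ p = Sum.inr j)) ∨
  (∃ i j, D.LeftmostVertical i j ∧ (p = Sum.inl i ∨ p = Sum.inr j))

/-- `D` is a Temperley-Lieb diagram of type `D`: a planar perfect matching of the marked points,
with dots subject to the usual conditions. -/
structure IsDiagram : Prop where
  irrefl : ∀ p, ¬ D.joined p p
  symm : ∀ p p', D.joined p p' → D.joined p' p
  matching : ∀ p, ∃! p', D.joined p p'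
  planar : ∀ p p' r r', D.joined p p' → D.joined r r' →
    ¬ (pos p < pos r ∧ pos r < pos p' ∧ pos p' < pos r')
  dotted_iff : ∀ p p', D.joined p p' → (D.dotted p ↔ D.dotted p')
  /-- The number of dots is one or even. -/
  one_or_even : D.numDots = 1 ∨ Even D.numDots
  /-- If it is even, the dots are on outer-most arcs. -/
  even_case : Even D.numDots → ∀ p, D.dotted p → D.Exposed p
  /-- If it is one, the dot is on the arc at the left-most bottom point. -/
  one_case : D.numDots = 1 → D.dotted (Sum.inr 0)
  /-- The diagram of `n + 1` vertical strands has no dot. -/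
  vertical_case : (∀ i, D.joined (Sum.inl i) (Sum.inr i)) → ∀ p, ¬ D.dotted p

/-- If the number of dots is odd, replace them by a single dot on the arc at the left-most bottom
point; otherwise leave the dots where they are. -/
def normalize : PreDiagram n where
  joined := D.joined
  dotted p := (Even D.numDots ∧ D.dotted p) ∨
    (Odd D.numDots ∧ (p = Sum.inr 0 ∨ D.joined p (Sum.inr 0)))

/-- The upside down diagram, with a unique dot moved to the arc at the left-most bottom point. -/
def flip : PreDiagram n :=
  normalize
    { joined := fun p p' => D.joined p.swap p'.swap
      dotted := fun p => D.dotted p.swap }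

end PreDiagram

/-! ### The diagram of a word

The diagrams of the generators `E_{s_1}, …, E_{s_l}` are stacked from top to bottom. The node
`(k, p)` is the point at horizontal position `p` on the level between the `k`-th and the
`(k+1)`-st generator, so that level `0` is the top and level `l` is the bottom. -/

/-- The arcs in the stack. In the layer of `E_i` with `i ≥ 1` (numbering positions from `0`) the
positions `i - 1` and `i` are joined by a cup and by a cap, and all other strands are vertical;
`E_0` has the same arcs as `E_1`. -/
inductive StackArc {n : ℕ} (w : List (Fin (n + 1))) : ℕ × Fin (n + 1) → ℕ × Fin (n + 1) → Prop
  | cup (k : ℕ) (s a b : Fin (n + 1)) (hs : w[k]? = some s)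
      (ha : a.val = s.val - 1) (hb : b.val = s.val - 1 + 1) : StackArc w (k, a) (k, b)
  | cap (k : ℕ) (s a b : Fin (n + 1)) (hs : w[k]? = some s)
      (ha : a.val = s.val - 1) (hb : b.val = s.val - 1 + 1) : StackArc w (k + 1, a) (k + 1, b)
  | vertical (k : ℕ) (s a : Fin (n + 1)) (hs : w[k]? = some s)
      (ha : a.val ≠ s.val - 1) (hb : a.val ≠ s.val - 1 + 1) : StackArc w (k, a) (k + 1, a)

/-- Two nodes are on the same strand or loop of the stack. -/
def Connected {n : ℕ} (w : List (Fin (n + 1))) : ℕ × Fin (n + 1) → ℕ × Fin (n + 1) → Prop :=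
  Relation.EqvGen (StackArc w)

/-- The node of the stack at a marked point. -/
def node {n : ℕ} (w : List (Fin (n + 1))) : Point n → ℕ × Fin (n + 1)
  | Sum.inl i => (0, i)
  | Sum.inr i => (w.length, i)

/-- The diagram obtained by stacking, with all loops deleted. The dots come from the generators
`E_0`, whose cup and cap (at the left-most position) both have a dot. -/
def stack {n : ℕ} (w : List (Fin (n + 1))) : PreDiagram n where
  joined p p' := p ≠ p' ∧ Connected w (node w p) (node w p')
  dotted p := ∃ k, w[k]? = some 0 ∧
    (Connected w (node w p) (k, 0) ∨ Connected w (node w p) (k + 1, 0))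

/-- The diagram of a (reduced) word. -/
def diagram {n : ℕ} (w : List (Fin (n + 1))) : PreDiagram n := (stack w).normalize

open Classical in
/-- The coefficient of the diagram `D` in the element with expansion `c`: every reduced word is
replaced by its diagram, and the coefficients of `D` are collected. -/
noncomputable def diagramCoef {n : ℕ} (c : TL n →₀ K) (D : PreDiagram n) : K :=
  ∑ b ∈ c.support.filter (fun b => ∃ w, IsReduced w ∧ word w = b ∧ diagram w = D), c b

end TLD

namespace TLD

/-- A labelled finite set of points on a line, regarded as a heap of pieces: two points interact
if their labels are equal or adjacent in a given graph. -/
@[ext]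
structure Heap (I : Type*) where
  label : ℕ → I
  pts : Finset ℕ

namespace Heap

open Classical in
/-- The points strictly between `a` and `b` that interact with `a`. -/
noncomputable def between {I : Type*} (G : SimpleGraph I) (h : Heap I) (a b : ℕ) : Finset ℕ :=
  h.pts.filter fun x => a < x ∧ x < b ∧ (h.label x = h.label a ∨ G.Adj (h.label x) (h.label a))

/-- The heap without the points in `S`. -/
def remove {I : Type*} (h : Heap I) (S : Finset ℕ) : Heap I := ⟨h.label, h.pts \ S⟩

/-- Consecutive points `a < b` with the same label and at most one adjacent point in between. -/
structure Pattern {I : Type*} (G : SimpleGraph I) (h : Heap I) (a b : ℕ) : Prop where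
  left_mem : a ∈ h.pts
  right_mem : b ∈ h.pts
  lt : a < b
  label_eq : h.label b = h.label a
  card_le : (h.between G a b).card ≤ 1
  label_ne : ∀ x ∈ h.between G a b, h.label x ≠ h.label a

/-- The heap obtained by cancelling a pattern. -/
noncomputable def reduce {I : Type*} (G : SimpleGraph I) (h : Heap I) (a b : ℕ) : Heap I :=
  h.remove (insert b (h.between G a b))

/-- `h'` arises from `h` by cancelling a pattern, which contributes `k` loops. -/
def Step {I : Type*} (G : SimpleGraph I) (h h' : Heap I) (k : ℕ) : Prop :=
  ∃ a b, h.Pattern G a b ∧ h' = h.reduce G a b ∧ k = 1 - (h.between G a b).card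

/-- Isomorphism of heaps. -/
def Iso {I : Type*} (G : SimpleGraph I) (h g : Heap I) : Prop :=
  ∃ φ : ℕ → ℕ, Set.BijOn φ h.pts g.pts ∧ (∀ x ∈ h.pts, g.label (φ x) = h.label x) ∧
    ∀ x ∈ h.pts, ∀ y ∈ h.pts, (h.label x = h.label y ∨ G.Adj (h.label x) (h.label y)) →
      x < y → φ x < φ y

variable {I : Type*} {G : SimpleGraph I}

theorem mem_between {h : Heap I} {a b x : ℕ} : x ∈ h.between G a b ↔
    x ∈ h.pts ∧ a < x ∧ x < b ∧ (h.label x = h.label a ∨ G.Adj (h.label x) (h.label a)) := by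
  simp [between]

theorem Iso.refl (h : Heap I) : Iso G h h :=
  ⟨id, Set.bijOn_id _, fun _ _ => rfl, fun _ _ _ _ _ h => h⟩

theorem Iso.symm {h g : Heap I} : Iso G h g → Iso G g h := by
  rintro ⟨φ, hb, hl, ho⟩
  have hinv := hb.invOn_invFunOn
  have hb' : Set.BijOn (Function.invFunOn φ (h.pts : Set ℕ)) g.pts h.pts :=
    (Set.bijOn_comm hinv).2 hb
  refine ⟨_, hb', fun x hx => ?_, fun x hx y hy hd hxy => ?_⟩
  · have := hl _ (hb'.mapsTo hx)
    rw [hinv.2 hx] at this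
    exact this.symm
  · have hx' := hb'.mapsTo hx
    have hy' := hb'.mapsTo hy
    have ex := hinv.2 hx
    have ey := hinv.2 hy
    generalize Function.invFunOn φ (h.pts : Set ℕ) x = x' at *
    generalize Function.invFunOn φ (h.pts : Set ℕ) y = y' at *
    subst ex ey
    rw [hl _ hx', hl _ hy'] at hd
    rcases lt_trichotomy x' y' with h1 | h1 | h1
    · exact h1
    · subst h1; omega
    · have := ho _ hy' _ hx' (hd.imp Eq.symm SimpleGraph.Adj.symm) h1
      omega

theorem Iso.trans {h g k : Heap I} : Iso G h g → Iso G g k → Iso G h k := by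
  rintro ⟨φ, hb, hl, ho⟩ ⟨ψ, hb', hl', ho'⟩
  refine ⟨ψ ∘ φ, hb'.comp hb, fun x hx => ?_, fun x hx y hy hd hxy => ?_⟩
  · rw [Function.comp_apply, hl' _ (hb.mapsTo hx), hl _ hx]
  · exact ho' _ (hb.mapsTo hx) _ (hb.mapsTo hy) (by rwa [hl _ hx, hl _ hy]) (ho _ hx _ hy hd hxy)

theorem Iso.card_eq {h g : Heap I} : Iso G h g → h.pts.card = g.pts.card := by
  rintro ⟨φ, hb, -⟩
  exact Finset.card_nbij φ hb.mapsTo hb.injOn hb.surjOn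

theorem Step.card_lt {h h' : Heap I} {k : ℕ} : Step G h h' k → h'.pts.card < h.pts.card := by
  rintro ⟨a, b, hp, rfl, -⟩
  refine Finset.card_lt_card ?_
  change h.pts \ _ ⊂ h.pts
  rw [Finset.ssubset_iff_of_subset Finset.sdiff_subset]
  exact ⟨b, hp.right_mem, by simp⟩

theorem Step.of_iso {h g h' : Heap I} {k : ℕ} (hi : Iso G h g) (hs : Step G h h' k) :
    ∃ g', Step G g g' k ∧ Iso G h' g' := by
  obtain ⟨φ, hb, hl, ho⟩ := hi
  obtain ⟨a, b, hp, rfl, rfl⟩ := hs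
  have ho' : ∀ x ∈ h.pts, ∀ y ∈ h.pts, (h.label x = h.label y ∨ G.Adj (h.label x) (h.label y)) →
      φ x < φ y → x < y := by
    intro x hx y hy hd hxy
    rcases lt_trichotomy x y with h1 | h1 | h1
    · exact h1
    · subst h1; omega
    · have := ho _ hy _ hx (hd.imp Eq.symm SimpleGraph.Adj.symm) h1
      omega
  have ha := hp.left_mem
  have hbm := hp.right_mem
  have hC : g.between G (φ a) (φ b) = (h.between G a b).image φ := by
    ext y
    simp only [mem_between, Finset.mem_image]
    constructor
    · rintro ⟨hy, h1, h2, h3⟩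
      obtain ⟨x, hx, rfl⟩ := hb.surjOn hy
      rw [hl _ hx, hl _ ha] at h3
      exact ⟨x, ⟨hx, ho' _ ha _ hx (h3.imp Eq.symm SimpleGraph.Adj.symm) h1,
        ho' _ hx _ hbm (by rwa [hp.label_eq]) h2, h3⟩, rfl⟩
    · rintro ⟨x, ⟨hx, h1, h2, h3⟩, rfl⟩
      refine ⟨hb.mapsTo hx, ho _ ha _ hx (h3.imp Eq.symm SimpleGraph.Adj.symm) h1,
        ho _ hx _ hbm (by rwa [hp.label_eq]) h2, by rwa [hl _ hx, hl _ ha]⟩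
  have hsub : ∀ x ∈ h.between G a b, x ∈ h.pts := fun x hx => (mem_between.1 hx).1
  have hcard : (g.between G (φ a) (φ b)).card = (h.between G a b).card := by
    rw [hC, Finset.card_image_of_injOn]
    exact hb.injOn.mono hsub
  refine ⟨_, ⟨φ a, φ b, ⟨hb.mapsTo ha, hb.mapsTo hbm,
    ho _ ha _ hbm (Or.inl hp.label_eq.symm) hp.lt, by rw [hl _ ha, hl _ hbm, hp.label_eq],
    hcard ▸ hp.card_le, ?_⟩, rfl, by rw [hcard]⟩, φ, ?_, ?_, ?_⟩
  · intro y hy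
    rw [hC, Finset.mem_image] at hy
    obtain ⟨x, hx, rfl⟩ := hy
    rw [hl _ (hsub x hx), hl _ ha]
    exact hp.label_ne x hx
  · have hS : ((insert b (h.between G a b) : Finset ℕ) : Set ℕ) ⊆ h.pts := by
      intro x hx
      rcases Finset.mem_insert.1 (Finset.mem_coe.1 hx) with rfl | hx
      exacts [hbm, hsub x hx]
    have := Set.InjOn.bijOn_image (f := φ)
      (s := (h.pts : Set ℕ) \ (insert b (h.between G a b) : Finset ℕ))
      (hb.injOn.mono Set.sdiff_subset)
    rw [hb.injOn.image_sdiff_subset hS, hb.image_eq] at this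
    simpa [reduce, remove, hC, Set.image_insert_eq] using this
  · intro x hx
    exact hl x (Finset.mem_sdiff.1 hx).1
  · intro x hx y hy
    exact ho x (Finset.mem_sdiff.1 hx).1 y (Finset.mem_sdiff.1 hy).1

theorem Step.after {h : Heap I} {a b a' b' c : ℕ} (p' : h.Pattern G a' b')
    (hc : c ∈ (h.reduce G a b).pts) (hb' : b' ∈ (h.reduce G a b).pts) (hlt : c < b')
    (hl : h.label c = h.label a')
    (hC : (h.reduce G a b).between G c b' = h.between G a' b' \ h.between G a b) :
    Step G (h.reduce G a b)
      (h.remove (insert b (h.between G a b) ∪ insert b' (h.between G a' b')))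
      (1 - (h.between G a' b' \ h.between G a b).card) := by
  refine ⟨c, b', ⟨hc, hb', hlt, ?_, ?_, ?_⟩, ?_, ?_⟩
  · exact p'.label_eq.trans hl.symm
  · rw [hC]
    exact (Finset.card_le_card Finset.sdiff_subset).trans p'.card_le
  · rw [hC]
    intro x hx
    exact (p'.label_ne x (Finset.sdiff_subset hx)).trans_eq hl.symm
  · ext x
    · rfl
    · change x ∈ h.pts \ _ ↔ x ∈ (h.pts \ _) \ _
      rw [hC]
      simp only [Finset.mem_sdiff, Finset.mem_union, Finset.mem_insert]
      tauto
  · rw [hC]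

theorem Pattern.loops_add {h : Heap I} {a b a' b' : ℕ} (p : h.Pattern G a b)
    (p' : h.Pattern G a' b') :
    1 - (h.between G a b).card + (1 - (h.between G a' b' \ h.between G a b).card) =
      1 - (h.between G a' b').card + (1 - (h.between G a b \ h.between G a' b').card) := by
  have h1 := p.card_le
  have h2 := p'.card_le
  have h3 := Finset.card_sdiff_add_card (h.between G a b) (h.between G a' b')
  have h4 := Finset.card_sdiff_add_card (h.between G a' b') (h.between G a b)
  rw [Finset.union_comm] at h4
  have h5 := Finset.card_le_card (Finset.sdiff_subset (s := h.between G a b) (t := h.between G a' b'))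
  have h6 := Finset.card_le_card (Finset.sdiff_subset (s := h.between G a' b') (t := h.between G a b))
  omega

theorem mem_reduce {h : Heap I} {a b x : ℕ} :
    x ∈ (h.reduce G a b).pts ↔ x ∈ h.pts ∧ x ≠ b ∧ x ∉ h.between G a b := by
  simp [reduce, remove]

theorem mem_between_reduce {h : Heap I} {a b c d x : ℕ} :
    x ∈ (h.reduce G a b).between G c d ↔
      x ∈ h.between G c d ∧ x ≠ b ∧ x ∉ h.between G a b := by
  rw [mem_between, mem_reduce, mem_between (a := c)]
  change _ ∧ c < x ∧ x < d ∧ (h.label x = h.label c ∨ G.Adj (h.label x) (h.label c)) ↔ _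
  tauto

/-- Patterns that do not overlap can be cancelled one after the other. -/
theorem Pattern.commute  {h : Heap I} {a b a' b' : ℕ}
    (p' : h.Pattern G a' b') (h1 : b ∉ insert a' (insert b' (h.between G a' b')))
    (h2 : a' ∉ h.between G a b) (h3 : b' ∉ h.between G a b) :
    Step G (h.reduce G a b)
      (h.remove (insert b (h.between G a b) ∪ insert b' (h.between G a' b')))
      (1 - (h.between G a' b' \ h.between G a b).card) := by
  simp only [Finset.mem_insert, not_or] at h1
  refine Step.after p' (c := a') ?_ ?_ p'.lt rfl ?_
  · exact mem_reduce.2 ⟨p'.left_mem, Ne.symm h1.1, h2⟩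
  · exact mem_reduce.2 ⟨p'.right_mem, Ne.symm h1.2.1, h3⟩
  · ext x
    rw [mem_between_reduce, Finset.mem_sdiff]
    constructor
    · tauto
    · rintro ⟨hx, hx'⟩
      exact ⟨hx, fun hxb => h1.2.2 (hxb ▸ hx), hx'⟩

/-- Two consecutive patterns with the same label can be cancelled one after the other. -/
theorem Pattern.consecutive {h : Heap I} {a b c : ℕ} (p : h.Pattern G a b)
    (p' : h.Pattern G b c) :
    Step G (h.reduce G a b)
      (h.remove (insert b (h.between G a b) ∪ insert c (h.between G b c)))
      (1 - (h.between G b c \ h.between G a b).card) ∧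
    Step G (h.reduce G b c)
      (h.remove (insert b (h.between G a b) ∪ insert c (h.between G b c)))
      (1 - (h.between G a b \ h.between G b c).card) := by
  have hab := p.lt
  have hbc := p'.lt
  have ha := p.left_mem
  have hb := p.right_mem
  have hc := p'.right_mem
  have hl := p.label_eq
  have hl' := p'.label_eq
  constructor
  · refine Step.after p' (c := a) ?_ ?_ (hab.trans hbc) hl.symm ?_
    · exact mem_reduce.2 ⟨ha, by omega, fun hm => by have := mem_between.1 hm; omega⟩
    · exact mem_reduce.2 ⟨hc, by omega, fun hm => by have := mem_between.1 hm; omega⟩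
    · ext x
      rw [mem_between_reduce, Finset.mem_sdiff]
      simp only [mem_between]
      rw [hl]
      constructor
      · rintro ⟨⟨h1, h2, h3, h4⟩, h5, h6⟩
        refine ⟨⟨h1, ?_, h3, h4⟩, h6⟩
        by_contra h7
        exact h6 ⟨h1, h2, by omega, h4⟩
      · rintro ⟨⟨h1, h2, h3, h4⟩, h6⟩
        exact ⟨⟨h1, by omega, h3, h4⟩, by omega, h6⟩
  · rw [Finset.union_comm]
    refine Step.after p (c := a) ?_ ?_ hab rfl ?_
    · exact mem_reduce.2 ⟨ha, by omega, fun hm => by have := mem_between.1 hm; omega⟩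
    · exact mem_reduce.2 ⟨hb, by omega, fun hm => by have := mem_between.1 hm; omega⟩
    · ext x
      rw [mem_between_reduce, Finset.mem_sdiff]
      simp only [mem_between]
      constructor
      · tauto
      · rintro ⟨⟨h1, h2, h3, h4⟩, h6⟩
        exact ⟨⟨h1, h2, h3, h4⟩, by omega, h6⟩

theorem Pattern.between_eq {h : Heap I} {a b x : ℕ} (p : h.Pattern G a b)
    (hx : x ∈ h.between G a b) : h.between G a b = {x} :=
  Finset.eq_singleton_iff_unique_mem.2
    ⟨hx, fun _ hy => Finset.card_le_one.1 p.card_le _ hy _ hx⟩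

theorem Pattern.adj {h : Heap I} {a b x : ℕ} (p : h.Pattern G a b)
    (hx : x ∈ h.between G a b) : G.Adj (h.label x) (h.label a) :=
  (mem_between.1 hx).2.2.2.resolve_left (p.label_ne x hx)

theorem Pattern.left_mem_between {h : Heap I} {a b a' b' : ℕ} (p : h.Pattern G a b)
    (p' : h.Pattern G a' b') (hb : b ∈ h.between G a' b') : a' ∈ h.between G a b := by
  have hadj := p'.adj hb
  have hab := p.lt
  have hm := mem_between.1 hb
  have hadj' : G.Adj (h.label a') (h.label a) := p.label_eq ▸ hadj.symm
  refine mem_between.2 ⟨p'.left_mem, ?_, hm.2.1, Or.inr hadj'⟩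
  by_contra hlt
  have hne : a ≠ a' := fun e => by subst e; exact G.irrefl hadj'
  have : a ∈ h.between G a' b' := mem_between.2 ⟨p.left_mem, by omega, by omega, Or.inr hadj'.symm⟩
  rw [p'.between_eq hb, Finset.mem_singleton] at this
  omega

theorem Pattern.right_mem_between {h : Heap I} {a b a' b' : ℕ} (p : h.Pattern G a b)
    (p' : h.Pattern G a' b') (ha : a ∈ h.between G a' b') : b' ∈ h.between G a b := by
  have hadj := p'.adj ha
  have hab := p.lt
  have hm := mem_between.1 ha
  have hadj' : G.Adj (h.label b') (h.label a) := p'.label_eq ▸ hadj.symm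
  refine mem_between.2 ⟨p'.right_mem, hm.2.2.1, ?_, Or.inr hadj'⟩
  by_contra hlt
  have hne : b ≠ b' := fun e => by subst e; rw [p.label_eq] at hadj'; exact G.irrefl hadj'
  have : b ∈ h.between G a' b' :=
    mem_between.2 ⟨p.right_mem, by omega, by omega, Or.inr (p.label_eq ▸ hadj)⟩
  rw [p'.between_eq ha, Finset.mem_singleton] at this
  omega

/-- Overlapping patterns with labels `i, j, i` and `j, i, j` have isomorphic reductions. -/
theorem Pattern.overlap {h : Heap I} {a b a' b' : ℕ} (p : h.Pattern G a b)
    (p' : h.Pattern G a' b') (hb : b ∈ h.between G a' b') :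
    Iso G (h.reduce G a b) (h.reduce G a' b') ∧
      1 - (h.between G a b).card = 1 - (h.between G a' b').card := by
  have ha' := p.left_mem_between p' hb
  have hadj := p'.adj hb
  have e := p.between_eq ha'
  have e' := p'.between_eq hb
  have hab := mem_between.1 hb
  have hab' := mem_between.1 ha'
  have hl := p.label_eq
  have hl' := p'.label_eq
  have hb'm := p'.right_mem
  have key : ∀ x ∈ h.pts, x ≠ b → (h.label x = h.label a' ∨ G.Adj (h.label x) (h.label a')) →
      ¬ (a' < x ∧ x < b') := by
    rintro x hx hxb hd ⟨h1, h2⟩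
    have : x ∈ h.between G a' b' := mem_between.2 ⟨hx, h1, h2, hd⟩
    rw [e', Finset.mem_singleton] at this
    exact hxb this
  refine ⟨⟨fun x => if x = b' then a' else x, ?_, ?_, ?_⟩, by rw [e, e']; rfl⟩
  · refine ⟨?_, ?_, ?_⟩
    · intro x hx
      rw [Finset.mem_coe, mem_reduce, e, Finset.mem_singleton] at hx
      rw [Finset.mem_coe, mem_reduce, e', Finset.mem_singleton]
      have := p'.left_mem
      dsimp only
      split_ifs with h1
      · exact ⟨this, by omega, by omega⟩
      · exact ⟨hx.1, h1, hx.2.1⟩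
    · intro x hx y hy hxy
      rw [Finset.mem_coe, mem_reduce, e, Finset.mem_singleton] at hx hy
      dsimp only at hxy
      split_ifs at hxy <;> omega
    · intro y hy
      rw [Finset.mem_coe, mem_reduce, e', Finset.mem_singleton] at hy
      by_cases h1 : y = a'
      · refine ⟨b', ?_, by simp [h1]⟩
        rw [Finset.mem_coe, mem_reduce, e, Finset.mem_singleton]
        exact ⟨hb'm, by omega, by omega⟩
      · refine ⟨y, ?_, by simp [hy.2.1]⟩
        rw [Finset.mem_coe, mem_reduce, e, Finset.mem_singleton]
        exact ⟨hy.1, hy.2.2, h1⟩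
  · intro x hx
    change h.label (if x = b' then a' else x) = h.label x
    split_ifs with h1
    · rw [h1, hl']
    · rfl
  · intro x hx y hy hd hxy
    rw [mem_reduce, e, Finset.mem_singleton] at hx hy
    change h.label x = h.label y ∨ G.Adj (h.label x) (h.label y) at hd
    dsimp only
    split_ifs with h1 h2 h2
    · omega
    · omega
    · subst h2
      rw [hl'] at hd
      have := key x hx.1 hx.2.1 hd
      omega
    · exact hxy

theorem Step.local_confluence  {h h₁ h₂ : Heap I} {k₁ k₂ : ℕ} (s₁ : Step G h h₁ k₁)
    (s₂ : Step G h h₂ k₂) : (Iso G h₁ h₂ ∧ k₁ = k₂) ∨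
      ∃ h₃ l₁ l₂, Step G h₁ h₃ l₁ ∧ Step G h₂ h₃ l₂ ∧ k₁ + l₁ = k₂ + l₂ := by
  obtain ⟨a, b, p, rfl, rfl⟩ := s₁
  obtain ⟨a', b', p', rfl, rfl⟩ := s₂
  have hloop := p.loops_add p'
  have hab := p.lt
  have hab' := p'.lt
  have hl := p.label_eq
  have hl' := p'.label_eq
  by_cases e₁ : b = a'
  · subst e₁
    obtain ⟨t₁, t₂⟩ := p.consecutive p'
    exact Or.inr ⟨_, _, _, t₁, t₂, hloop⟩
  by_cases e₂ : b' = a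
  · subst e₂
    obtain ⟨t₁, t₂⟩ := p'.consecutive p
    exact Or.inr ⟨_, _, _, t₂, t₁, hloop⟩
  by_cases e₃ : b = b'
  · subst e₃
    have : a = a' := by
      rcases lt_trichotomy a a' with h1 | h1 | h1
      · exact absurd (by rw [← hl', hl])
          (p.label_ne a' (mem_between.2 ⟨p'.left_mem, h1, hab', by rw [← hl', hl]; simp⟩))
      · exact h1
      · exact absurd (by rw [← hl', hl])
          (p'.label_ne a (mem_between.2 ⟨p.left_mem, h1, hab, by rw [← hl', hl]; simp⟩))
    subst this
    exact Or.inl ⟨Iso.refl _, rfl⟩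
  by_cases o₁ : b ∈ h.between G a' b'
  · exact Or.inl (p.overlap p' o₁)
  by_cases o₂ : b' ∈ h.between G a b
  · obtain ⟨t, ht⟩ := p'.overlap p o₂
    exact Or.inl ⟨t.symm, ht.symm⟩
  have o₃ : a' ∉ h.between G a b := fun o => o₁ (p'.right_mem_between p o)
  have o₄ : a ∉ h.between G a' b' := fun o => o₂ (p.right_mem_between p' o)
  refine Or.inr ⟨_, _, _, p'.commute (by simp [*]) o₃ o₂, ?_, hloop⟩
  rw [Finset.union_comm]
  exact p.commute (by simp [*, Ne.symm]) o₄ o₁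

/-- A heap without patterns. -/
def Irred (G : SimpleGraph I) (h : Heap I) : Prop := ∀ h' k, ¬ Step G h h' k

/-- `h` reduces to the irreducible heap `g`, with `k` loops on the way. -/
inductive NF (G : SimpleGraph I) : Heap I → Heap I → ℕ → Prop
  | iso {h g : Heap I} (hi : Iso G h g) (hg : Irred G g) : NF G h g 0
  | step {h h' g : Heap I} {k l : ℕ} (hs : Step G h h' k) (hn : NF G h' g l) : NF G h g (k + l)

theorem Irred.of_iso {h g : Heap I} (hh : Irred G h) (hi : Iso G h g) : Irred G g := by
  intro g' k hs
  obtain ⟨h', hs', -⟩ := hs.of_iso hi.symm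
  exact hh _ _ hs'

theorem NF.of_iso {h g : Heap I} {k : ℕ} (hn : NF G h g k) :
    ∀ {h'}, Iso G h' h → NF G h' g k := by
  induction hn with
  | iso hi hg => exact fun hi' => .iso (hi'.trans hi) hg
  | step hs _ ih =>
    intro h' hi'
    obtain ⟨h'', hs', hi''⟩ := hs.of_iso hi'.symm
    exact .step hs' (ih hi''.symm)

theorem exists_nf (G : SimpleGraph I) (h : Heap I) : ∃ g k, NF G h g k := by
  induction hN : h.pts.card using Nat.strong_induction_on generalizing h with
  | _ N ih =>
    by_cases hh : Irred G h
    · exact ⟨h, 0, .iso (Iso.refl h) hh⟩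
    · simp only [Irred, not_forall, not_not] at hh
      obtain ⟨h', k, hs⟩ := hh
      obtain ⟨g, l, hn⟩ := ih _ (hN ▸ hs.card_lt) h' rfl
      exact ⟨g, _, .step hs hn⟩

theorem NF.unique {h g g' : Heap I} {k k' : ℕ} (hn : NF G h g k) (hn' : NF G h g' k') :
    Iso G g g' ∧ k = k' := by
  induction hN : h.pts.card using Nat.strong_induction_on generalizing h g g' k k' with
  | _ N ih =>
    subst hN
    cases hn with
    | iso hi hg =>
      cases hn' with
      | iso hi' _ => exact ⟨hi.symm.trans hi', rfl⟩
      | step hs _ => exact absurd hs (hg.of_iso hi.symm _ _)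
    | @step _ h₁ _ k₁ m₁ hs hn =>
      cases hn' with
      | iso hi' hg' => exact absurd hs (hg'.of_iso hi'.symm _ _)
      | @step _ h₂ _ k₂ m₂ hs' hn' =>
        rcases hs.local_confluence hs' with ⟨hi, rfl⟩ | ⟨h₃, l₁, l₂, t₁, t₂, hl⟩
        · obtain ⟨h1, rfl⟩ := ih _ hs.card_lt hn (hn'.of_iso hi) rfl
          exact ⟨h1, rfl⟩
        · obtain ⟨f, m, hf⟩ := exists_nf G h₃
          obtain ⟨i₁, e₁⟩ := ih _ hs.card_lt hn (.step t₁ hf) rfl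
          obtain ⟨i₂, e₂⟩ := ih _ hs'.card_lt hn' (.step t₂ hf) rfl
          exact ⟨i₁.trans i₂.symm, by omega⟩

/-- Isomorphism of heaps as a setoid. -/
def isoSetoid (G : SimpleGraph I) : Setoid (Heap I) := ⟨Iso G, Iso.refl, Iso.symm, Iso.trans⟩

/-- Isomorphism classes of heaps. -/
abbrev Class (G : SimpleGraph I) : Type _ := Quotient (isoSetoid G)

/-- The class of a heap. -/
def cls (G : SimpleGraph I) (h : Heap I) : Class G := Quotient.mk (isoSetoid G) h

theorem cls_eq_iff {h g : Heap I} : cls G h = cls G g ↔ Iso G h g :=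
  ⟨fun e => Quotient.exact (s := isoSetoid G) e, fun e => Quotient.sound (s := isoSetoid G) e⟩

section Value
variable {R : Type*} [CommRing R]

/-- The normal form of `h` in the free module on classes of heaps, a loop having the value `d`. -/
noncomputable def value (G : SimpleGraph I) (d : R) (h : Heap I) : Class G →₀ R :=
  Finsupp.single (cls G (exists_nf G h).choose) (d ^ (exists_nf G h).choose_spec.choose)

theorem NF.value_eq {h g : Heap I} {k : ℕ} (hn : NF G h g k) (d : R) :
    value G d h = Finsupp.single (cls G g) (d ^ k) := by
  obtain ⟨h1, h2⟩ := (exists_nf G h).choose_spec.choose_spec.unique hn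
  rw [value, h2, cls_eq_iff.2 h1]

theorem Iso.value_eq {h g : Heap I} (hi : Iso G h g) (d : R) : value G d h = value G d g := by
  obtain ⟨f, k, hf⟩ := exists_nf G g
  rw [hf.value_eq, (hf.of_iso hi).value_eq]

theorem Step.value_eq {h h' : Heap I} {k : ℕ} (hs : Step G h h' k) (d : R) :
    value G d h = d ^ k • value G d h' := by
  obtain ⟨f, l, hf⟩ := exists_nf G h'
  rw [hf.value_eq, (NF.step hs hf).value_eq, pow_add]
  simp

theorem Irred.value_eq {h : Heap I} (hh : Irred G h) (d : R) :
    value G d h = Finsupp.single (cls G h) 1 := by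
  rw [(NF.iso (Iso.refl h) hh).value_eq, pow_zero]

end Value

/-- The heap with a new point labelled `i` in front. -/
def cons (i : I) (h : Heap I) : Heap I where
  label x := Nat.casesOn x i h.label
  pts := insert 0 (h.pts.map ⟨Nat.succ, Nat.succ_injective⟩)

@[simp] theorem cons_label_zero (i : I) (h : Heap I) : (h.cons i).label 0 = i := rfl

@[simp] theorem cons_label_succ (i : I) (h : Heap I) (x : ℕ) :
    (h.cons i).label (x + 1) = h.label x := rfl

@[simp] theorem zero_mem_cons (i : I) (h : Heap I) : 0 ∈ (h.cons i).pts := by simp [cons]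

@[simp] theorem succ_mem_cons (i : I) (h : Heap I) (x : ℕ) :
    x + 1 ∈ (h.cons i).pts ↔ x ∈ h.pts := by simp [cons]

theorem Iso.of_maps {h g : Heap I} (φ ψ : ℕ → ℕ)
    (h1 : ∀ x ∈ h.pts, φ x ∈ g.pts ∧ g.label (φ x) = h.label x ∧ ψ (φ x) = x)
    (h2 : ∀ y ∈ g.pts, ψ y ∈ h.pts ∧ φ (ψ y) = y)
    (h3 : ∀ x ∈ h.pts, ∀ y ∈ h.pts, (h.label x = h.label y ∨ G.Adj (h.label x) (h.label y)) →
      x < y → φ x < φ y) : Iso G h g :=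
  ⟨φ, ⟨fun x hx => (h1 x hx).1,
    fun x hx y hy e => by rw [← (h1 x hx).2.2, e, (h1 y hy).2.2],
    fun y hy => ⟨ψ y, (h2 y hy).1, (h2 y hy).2⟩⟩, fun x hx => (h1 x hx).2.1, h3⟩

theorem Iso.cons {h g : Heap I} (hi : Iso G h g) (i : I) : Iso G (h.cons i) (g.cons i) := by
  obtain ⟨φ, hb, hl, ho⟩ := hi
  have hinv := hb.invOn_invFunOn
  have hb' : Set.BijOn (Function.invFunOn φ (h.pts : Set ℕ)) g.pts h.pts :=
    (Set.bijOn_comm hinv).2 hb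
  refine Iso.of_maps (fun x => Nat.casesOn x 0 fun x => φ x + 1)
    (fun x => Nat.casesOn x 0 fun x => Function.invFunOn φ (h.pts : Set ℕ) x + 1) ?_ ?_ ?_
  · rintro (_ | x) hx
    · simp
    · rw [succ_mem_cons] at hx
      refine ⟨?_, hl x hx, ?_⟩
      · exact (succ_mem_cons _ _ _).2 (hb.mapsTo hx)
      · exact congrArg (· + 1) (hinv.1 hx)
  · rintro (_ | x) hx
    · simp
    · rw [succ_mem_cons] at hx
      refine ⟨?_, ?_⟩
      · exact (succ_mem_cons _ _ _).2 (hb'.mapsTo hx)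
      · exact congrArg (· + 1) (hinv.2 hx)
  · rintro (_ | x) hx (_ | y) hy hd hxy
    · omega
    · simp
    · omega
    · rw [succ_mem_cons] at hx hy
      exact Nat.succ_lt_succ (ho x hx y hy hd (by omega))

theorem between_cons (i : I) (h : Heap I) (a b : ℕ) :
    (h.cons i).between G (a + 1) (b + 1) =
      (h.between G a b).map ⟨Nat.succ, Nat.succ_injective⟩ := by
  ext x
  rcases x with _ | x
  · simp [mem_between]
  · simp [mem_between]

theorem Step.cons {h g : Heap I} {k : ℕ} (hs : Step G h g k) (i : I) :
    Step G (h.cons i) (g.cons i) k := by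
  obtain ⟨a, b, p, rfl, rfl⟩ := hs
  have hc := p.card_le
  refine ⟨a + 1, b + 1, ⟨?_, ?_, ?_, ?_, ?_, ?_⟩, ?_, ?_⟩
  · simpa using p.left_mem
  · simpa using p.right_mem
  · simpa using p.lt
  · exact p.label_eq
  · rw [between_cons, Finset.card_map]
    exact hc
  · rw [between_cons]
    intro x hx
    obtain ⟨y, hy, rfl⟩ := Finset.mem_map.1 hx
    exact p.label_ne y hy
  · ext x
    · rfl
    · rw [mem_reduce, between_cons]
      rcases x with _ | x
      · simp
      · simp [mem_reduce]
  · rw [between_cons, Finset.card_map]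

theorem NF.value_cons {R : Type*} [CommRing R] {h g : Heap I} {k : ℕ} (hn : NF G h g k) (i : I)
    (d : R) : value G d (h.cons i) = d ^ k • value G d (g.cons i) := by
  induction hn with
  | iso hi _ => rw [pow_zero, one_smul, (hi.cons i).value_eq]
  | step hs _ ih => rw [(hs.cons i).value_eq, ih, smul_smul, pow_add]

theorem cons_cons_self (i : I) (h : Heap I) :
    ∃ g, Step G ((h.cons i).cons i) g 1 ∧ Iso G g (h.cons i) := by
  have hC : ((h.cons i).cons i).between G 0 1 = ∅ := by
    ext x
    simp only [mem_between, Finset.notMem_empty, iff_false]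
    omega
  refine ⟨_, ⟨0, 1, ⟨by simp, by simp, by simp, rfl, by simp [hC], by simp [hC]⟩, rfl, by simp [hC]⟩,
    Iso.of_maps (fun x => x - 1) (fun x => Nat.casesOn x 0 fun x => x + 2) ?_ ?_ ?_⟩
  · intro x hx
    rw [mem_reduce] at hx
    rcases x with _ | _ | x
    · simp [reduce, remove]
    · omega
    · simpa [reduce, remove] using hx.1
  · rintro (_ | x) hx
    · simp [mem_reduce, hC]
    · simpa [mem_reduce, hC] using hx
  · intro x hx y hy _ hxy
    rw [mem_reduce] at hx hy
    omega

theorem cons_cons_cons {i j : I} (hij : G.Adj i j) (h : Heap I) :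
    ∃ g, Step G (((h.cons i).cons j).cons i) g 0 ∧ Iso G g (h.cons i) := by
  have hC : (((h.cons i).cons j).cons i).between G 0 2 = {1} := by
    ext x
    rw [mem_between, Finset.mem_singleton]
    constructor
    · omega
    · rintro rfl
      simp [hij.symm]
  refine ⟨_, ⟨0, 2, ⟨by simp, by simp, by simp, rfl, by simp [hC], ?_⟩, rfl, by simp [hC]⟩,
    Iso.of_maps (fun x => x - 2) (fun x => Nat.casesOn x 0 fun x => x + 3) ?_ ?_ ?_⟩
  · simp [hC, hij.ne']
  · intro x hx
    rw [mem_reduce, hC, Finset.mem_singleton] at hx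
    rcases x with _ | _ | _ | x
    · simp [reduce, remove]
    · omega
    · omega
    · simpa [reduce, remove] using hx.1
  · rintro (_ | x) hx
    · simp [mem_reduce, hC]
    · simpa [mem_reduce, hC] using hx
  · intro x hx y hy _ hxy
    rw [mem_reduce, hC, Finset.mem_singleton] at hx hy
    omega

theorem cons_comm {i j : I} (hne : i ≠ j) (hij : ¬ G.Adj i j) (h : Heap I) :
    Iso G ((h.cons j).cons i) ((h.cons i).cons j) := by
  have key : ∀ (i j : I), ∀ x ∈ ((h.cons j).cons i).pts,
      Equiv.swap 0 1 x ∈ ((h.cons i).cons j).pts ∧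
      ((h.cons i).cons j).label (Equiv.swap 0 1 x) = ((h.cons j).cons i).label x := by
    rintro i j (_ | _ | x) hx
    · simp
    · simp
    · rw [Equiv.swap_apply_of_ne_of_ne (by omega) (by omega)]
      simpa using hx
  refine Iso.of_maps (Equiv.swap 0 1) (Equiv.swap 0 1) ?_ ?_ ?_
  · intro x hx
    exact ⟨(key i j x hx).1, (key i j x hx).2, Equiv.swap_apply_self _ _ _⟩
  · intro x hx
    exact ⟨(key j i x hx).1, Equiv.swap_apply_self _ _ _⟩
  · rintro (_ | _ | x) hx (_ | _ | y) hy hd hxy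
    · omega
    · simp [hne, hij] at hd
    · rw [Equiv.swap_apply_left, Equiv.swap_apply_of_ne_of_ne] <;> omega
    · omega
    · omega
    · rw [Equiv.swap_apply_right, Equiv.swap_apply_of_ne_of_ne] <;> omega
    · omega
    · omega
    · rwa [Equiv.swap_apply_of_ne_of_ne, Equiv.swap_apply_of_ne_of_ne] <;> omega

end Heap

theorem word_nil {n : ℕ} : (word [] : TL n) = 1 := rfl

theorem word_cons {n : ℕ} (i : Fin (n + 1)) (w : List (Fin (n + 1))) :
    word (i :: w) = E i * word w := by
  simp [word]

theorem word_append {n : ℕ} (v w : List (Fin (n + 1))) : word (v ++ w) = word v * word w := by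
  simp [word]

theorem Adjacent.symm {i j : ℕ} (h : Adjacent i j) : Adjacent j i := by
  unfold Adjacent at *
  omega

theorem not_adjacent_self (i : ℕ) : ¬ Adjacent i i := by
  unfold Adjacent
  omega

/-- The Dynkin diagram `D_{n+1}`. -/
def dynkin (n : ℕ) : SimpleGraph (Fin (n + 1)) where
  Adj i j := Adjacent i.val j.val
  symm := ⟨fun _ _ h => h.symm⟩
  loopless := ⟨fun _ => not_adjacent_self _⟩

theorem word_map_eq_of_extract {n : ℕ} (f : ℕ → Fin (n + 1)) (t : ℕ) :
    ∀ l : List ℕ, l.Pairwise (· ≤ ·) → t ∈ l →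
      (∀ y ∈ l, y < t → ¬ (dynkin n).Adj (f y) (f t)) →
      word (l.map f) = E (f t) * word ((l.erase t).map f)
  | [], _, h, _ => by simp at h
  | x :: l, hs, h, hc => by
    by_cases hx : x = t
    · subst hx
      rw [List.erase_cons_head, List.map_cons, word_cons]
    · have ht : t ∈ l := by
        rcases List.mem_cons.1 h with h | h
        exacts [absurd h.symm hx, h]
      have hxt : x < t := lt_of_le_of_ne (List.rel_of_pairwise_cons hs ht) hx
      rw [List.erase_cons_tail (by simpa using hx), List.map_cons, List.map_cons, word_cons,
        word_cons, word_map_eq_of_extract f t l hs.of_cons ht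
          (fun y hy => hc y (List.mem_cons_of_mem _ hy)),
        ← mul_assoc, ← mul_assoc, E_comm _ _ (hc x List.mem_cons_self hxt)]

namespace Heap
variable {n : ℕ}

/-- The product of the generators given by the labels of a heap, from left to right. -/
noncomputable def eval (h : Heap (Fin (n + 1))) : TL n := word ((h.pts.sort (· ≤ ·)).map h.label)

theorem eval_extract {h : Heap (Fin (n + 1))} {t : ℕ} (ht : t ∈ h.pts)
    (hc : ∀ y ∈ h.pts, y < t → ¬ (dynkin n).Adj (h.label y) (h.label t)) :
    h.eval = E (h.label t) * (h.remove {t}).eval := by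
  have hs : ((h.pts \ {t}).sort (· ≤ ·)) = (h.pts.sort (· ≤ ·)).erase t := by
    refine List.Perm.eq_of_pairwise' (r := (· ≤ ·)) (Finset.pairwise_sort _ _)
      ((Finset.pairwise_sort _ _).sublist List.erase_sublist) ?_
    rw [List.perm_ext_iff_of_nodup (Finset.sort_nodup _ _) ((Finset.sort_nodup _ _).erase _)]
    intro x
    rw [(Finset.sort_nodup _ _).mem_erase_iff]
    simp [and_comm]
  simp only [eval, remove]
  rw [hs]
  exact word_map_eq_of_extract _ _ _ (Finset.pairwise_sort _ _) (by simpa using ht)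
    (by simpa using hc)

theorem Iso.eval_eq {h g : Heap (Fin (n + 1))} (hi : Iso (dynkin n) h g) : h.eval = g.eval := by
  induction hN : h.pts.card generalizing h g with
  | zero =>
    have h0 := hi.card_eq
    rw [hN] at h0
    rw [Finset.card_eq_zero] at hN
    simp [eval, hN, Finset.card_eq_zero.1 h0.symm]
  | succ N ih =>
    obtain ⟨φ, hb, hl, ho⟩ := hi
    have hne : h.pts.Nonempty := by rw [← Finset.card_pos]; omega
    have hm := h.pts.min'_mem hne
    have hmin : ∀ y ∈ h.pts, h.pts.min' hne ≤ y := fun y hy => h.pts.min'_le y hy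
    generalize h.pts.min' hne = m at hm hmin
    rw [eval_extract hm, eval_extract (h := g) (t := φ m) (hb.mapsTo hm), hl _ hm]
    · congr 1
      refine ih ⟨φ, ?_, ?_, ?_⟩ ?_
      · have := hb.sdiff_singleton hm
        simpa [remove] using this
      · exact fun x hx => hl x (Finset.mem_sdiff.1 hx).1
      · exact fun x hx y hy => ho x (Finset.mem_sdiff.1 hx).1 y (Finset.mem_sdiff.1 hy).1
      · simp only [remove]
        rw [Finset.card_sdiff_of_subset (by simpa using hm), hN]
        simp
    · intro y hy hlt hadj
      obtain ⟨x, hx, rfl⟩ := hb.surjOn hy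
      rw [hl _ hx, hl _ hm] at hadj
      have hxm : x ≠ m := fun e => by subst e; omega
      have := ho _ hm _ hx (Or.inr hadj.symm) (lt_of_le_of_ne (hmin x hx) (Ne.symm hxm))
      omega
    · intro y hy hlt
      have := hmin y hy
      omega

theorem between_remove_singleton {I : Type*} {G : SimpleGraph I} {h : Heap I} {a b x : ℕ}
    (hx : x ∉ h.between G a b) : (h.remove {x}).between G a b = h.between G a b := by
  ext y
  rw [mem_between] at *
  rw [mem_between]
  simp only [remove, Finset.mem_sdiff, Finset.mem_singleton]
  constructor
  · tauto
  · intro hy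
    refine ⟨⟨hy.1, ?_⟩, hy.2⟩
    rintro rfl
    exact hx hy

theorem Pattern.remove_singleton {I : Type*} {G : SimpleGraph I} {h : Heap I} {a b x : ℕ}
    (p : h.Pattern G a b) (ha : x ≠ a) (hb : x ≠ b) (hx : x ∉ h.between G a b) :
    (h.remove {x}).Pattern G a b := by
  have hC := between_remove_singleton hx
  refine ⟨?_, ?_, p.lt, p.label_eq, hC ▸ p.card_le, hC ▸ p.label_ne⟩
  · simpa [remove, ha.symm] using p.left_mem
  · simpa [remove, hb.symm] using p.right_mem

theorem remove_remove {I : Type*} (h : Heap I) (S T : Finset ℕ) :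
    (h.remove S).remove T = h.remove (S ∪ T) := by
  simp only [remove, sdiff_sdiff_left, Finset.sup_eq_union]

theorem mem_remove_singleton {I : Type*} {h : Heap I} {x y : ℕ} :
    y ∈ (h.remove {x}).pts ↔ y ∈ h.pts ∧ y ≠ x := by
  simp [remove]

theorem eval_eq_of_between_eq_empty {h : Heap (Fin (n + 1))} {a b : ℕ}
    (p : h.Pattern (dynkin n) a b) (hC : h.between (dynkin n) a b = ∅)
    (hmin : ∀ x ∈ h.pts, x < b → x = a) :
    h.eval = -qInt 2 • (h.reduce (dynkin n) a b).eval := by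
  have hab := p.lt
  have hr : h.reduce (dynkin n) a b = h.remove {b} := by simp [reduce, hC]
  have ha : a ∈ (h.remove {b}).pts := mem_remove_singleton.2 ⟨p.left_mem, hab.ne⟩
  have hb : b ∈ (h.remove {a}).pts := mem_remove_singleton.2 ⟨p.right_mem, hab.ne'⟩
  rw [hr, eval_extract p.left_mem, eval_extract hb, eval_extract ha, remove_remove, remove_remove,
    Finset.union_comm]
  · change E (h.label a) * (E (h.label b) * _) = _ • (E (h.label a) * _)
    rw [p.label_eq, ← mul_assoc, E_sq, smul_mul_assoc]
  · intro y hy hlt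
    have := hmin y (mem_remove_singleton.1 hy).1 (by omega)
    omega
  · intro y hy hlt
    rw [mem_remove_singleton] at hy
    have := hmin y hy.1 hlt
    omega
  · intro y hy hlt
    have := hmin y hy (by omega)
    omega

theorem eval_eq_of_between_eq_singleton {h : Heap (Fin (n + 1))} {a b c : ℕ}
    (p : h.Pattern (dynkin n) a b) (hC : h.between (dynkin n) a b = {c})
    (hmin : ∀ x ∈ h.pts, x < c → x = a) :
    h.eval = (h.reduce (dynkin n) a b).eval := by
  have hab := p.lt
  have hc := mem_between.1 (hC ▸ Finset.mem_singleton_self c : c ∈ h.between (dynkin n) a b)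
  have hadj := p.adj (hC ▸ Finset.mem_singleton_self c : c ∈ h.between (dynkin n) a b)
  have hr : h.reduce (dynkin n) a b = h.remove {b, c} := by simp [reduce, hC]
  have ha : a ∈ (h.remove {b, c}).pts := by
    simpa [remove] using ⟨p.left_mem, hab.ne, hc.2.1.ne⟩
  have hc' : c ∈ (h.remove {a}).pts := mem_remove_singleton.2 ⟨hc.1, by omega⟩
  have hb : b ∈ ((h.remove {a}).remove {c}).pts :=
    mem_remove_singleton.2 ⟨mem_remove_singleton.2 ⟨p.right_mem, hab.ne'⟩, by omega⟩
  rw [hr, eval_extract p.left_mem, eval_extract hc', eval_extract hb, eval_extract ha]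
  · change E (h.label a) * (E (h.label c) * (E (h.label b) * _)) = E (h.label a) * _
    rw [p.label_eq, ← mul_assoc, ← mul_assoc, E_braid _ _ hadj.symm]
    congr 2
    rw [remove_remove, remove_remove, remove_remove]
    congr 1
    ext x
    simp only [Finset.mem_union, Finset.mem_singleton, Finset.mem_insert]
    tauto
  · intro y hy hlt
    have := hmin y (Finset.mem_sdiff.1 hy).1 (by omega)
    omega
  · intro y hy hlt hadj'
    rw [mem_remove_singleton, mem_remove_singleton] at hy
    have hy' : y ∈ h.between (dynkin n) a b := by
      refine mem_between.2 ⟨hy.1.1, ?_, hlt, Or.inr (by rwa [← p.label_eq])⟩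
      by_contra h1
      have := hmin y hy.1.1 (by omega)
      omega
    rw [hC, Finset.mem_singleton] at hy'
    omega
  · intro y hy hlt
    rw [mem_remove_singleton] at hy
    have := hmin y hy.1 hlt
    omega
  · intro y hy hlt
    have := hmin y hy (by omega)
    omega

theorem Pattern.eval_eq {h : Heap (Fin (n + 1))} {a b : ℕ} (p : h.Pattern (dynkin n) a b) :
    h.eval = (-qInt 2) ^ (1 - (h.between (dynkin n) a b).card) •
      (h.reduce (dynkin n) a b).eval := by
  induction hN : h.pts.card generalizing h with
  | zero =>
    rw [Finset.card_eq_zero] at hN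
    have := p.left_mem
    simp [hN] at this
  | succ N ih =>
    obtain ⟨c, hc, hcb, hab⟩ : ∃ c ∈ insert b (h.between (dynkin n) a b),
        (c = b → h.between (dynkin n) a b = ∅) ∧ a < c ∧ c ≤ b := by
      rcases (h.between (dynkin n) a b).eq_empty_or_nonempty with h0 | ⟨c, hc⟩
      · exact ⟨b, by simp, fun _ => h0, p.lt, le_rfl⟩
      · have := mem_between.1 hc
        exact ⟨c, by simp [hc], fun e => by omega, by omega, by omega⟩
    by_cases hx : ((h.pts.filter fun x => x < c ∧ x ≠ a)).Nonempty
    · have hm := Finset.min'_mem _ hx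
      have hmin : ∀ y ∈ h.pts, y < c → y ≠ a → (h.pts.filter fun x => x < c ∧ x ≠ a).min' hx ≤ y :=
        fun y hy h1 h2 => Finset.min'_le _ _ (by simp [hy, h1, h2])
      generalize (h.pts.filter fun x => x < c ∧ x ≠ a).min' hx = x at hm hmin
      simp only [Finset.mem_filter] at hm
      have hxC : x ∉ h.between (dynkin n) a b := by
        intro h1
        rcases Finset.mem_insert.1 hc with rfl | hc
        · rw [hcb rfl] at h1
          simp at h1
        · rw [p.between_eq hc, Finset.mem_singleton] at h1
          omega
      have hext : ∀ y ∈ h.pts, y < x → ¬ (dynkin n).Adj (h.label y) (h.label x) := by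
        intro y hy hlt hadj
        have hya : y = a := by
          by_contra hya
          have := hmin y hy (by omega) hya
          omega
        subst hya
        exact hxC (mem_between.2 ⟨hm.1, hlt, by omega, Or.inr hadj.symm⟩)
      have hxr : x ∈ (h.reduce (dynkin n) a b).pts := mem_reduce.2 ⟨hm.1, by omega, hxC⟩
      rw [eval_extract hm.1 hext, eval_extract hxr
        (fun y hy => hext y (mem_reduce.1 hy).1),
        ih (p.remove_singleton hm.2.2 (by omega) hxC), between_remove_singleton hxC,
        mul_smul_comm]
      · congr 3
        rw [reduce, between_remove_singleton hxC, reduce, remove_remove, remove_remove,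
          Finset.union_comm]
      · simp only [remove]
        rw [Finset.card_sdiff_of_subset (by simpa using hm.1), hN]
        simp
    · rw [Finset.not_nonempty_iff_eq_empty, Finset.filter_eq_empty_iff] at hx
      have hmin : ∀ x ∈ h.pts, x < c → x = a := fun x h1 h2 => by
        by_contra h3
        exact hx h1 ⟨h2, h3⟩
      rcases Finset.mem_insert.1 hc with rfl | hc
      · rw [hcb rfl, Finset.card_empty, pow_one]
        exact eval_eq_of_between_eq_empty p (hcb rfl) hmin
      · rw [p.between_eq hc, Finset.card_singleton, pow_zero, one_smul]
        exact eval_eq_of_between_eq_singleton p (p.between_eq hc) hmin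

/-- The heap of a word. -/
def ofWord (w : List (Fin (n + 1))) : Heap (Fin (n + 1)) := w.foldr cons ⟨fun _ => 0, ∅⟩

@[simp] theorem ofWord_cons (i : Fin (n + 1)) (w : List (Fin (n + 1))) :
    ofWord (i :: w) = (ofWord w).cons i := rfl

theorem eval_cons (i : Fin (n + 1)) (h : Heap (Fin (n + 1))) :
    (h.cons i).eval = E i * h.eval := by
  have hs : (h.pts.map ⟨Nat.succ, Nat.succ_injective⟩).sort (· ≤ ·) =
      (h.pts.sort (· ≤ ·)).map Nat.succ := by
    refine List.Perm.eq_of_pairwise' (r := (· ≤ ·)) (Finset.pairwise_sort _ _) ?_ ?_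
    · rw [List.pairwise_map]
      exact (Finset.pairwise_sort _ _).imp Nat.succ_le_succ
    · rw [List.perm_ext_iff_of_nodup (Finset.sort_nodup _ _)
        ((Finset.sort_nodup _ _).map Nat.succ_injective)]
      simp
  simp only [eval, cons]
  rw [Finset.sort_insert _ (by simp) (by simp), hs, List.map_cons, word_cons, List.map_map]
  rfl

theorem eval_ofWord (w : List (Fin (n + 1))) : (ofWord w).eval = word w := by
  induction w with
  | nil => simp [ofWord, eval]
  | cons i w ih => rw [ofWord_cons, eval_cons, ih, word_cons]

theorem card_ofWord (w : List (Fin (n + 1))) : (ofWord w).pts.card = w.length := by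
  induction w with
  | nil => rfl
  | cons i w ih =>
    rw [ofWord_cons, cons, Finset.card_insert_of_notMem (by simp), Finset.card_map, ih,
      List.length_cons]

theorem irred_ofWord {w : List (Fin (n + 1))} (hw : IsReduced w) :
    Irred (dynkin n) (ofWord w) := by
  rintro h' k ⟨a, b, p, rfl, rfl⟩
  have h1 := p.eval_eq
  rw [eval_ofWord] at h1
  have h2 := hw _ _ h1
  rw [List.length_map, Finset.length_sort, ← card_ofWord w] at h2
  have h3 := Step.card_lt ⟨a, b, p, rfl, rfl⟩
  omega

/-- The action of a generator on the free module on classes of heaps. -/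
noncomputable def act (i : Fin (n + 1)) : Module.End K (Class (dynkin n) →₀ K) :=
  Finsupp.linearCombination K fun x => value (dynkin n) (-qInt 2) (cons i (Quotient.out x))

theorem act_single (i : Fin (n + 1)) (x : Class (dynkin n)) (r : K) :
    act i (Finsupp.single x r) =
      r • value (dynkin n) (-qInt 2) (cons i (Quotient.out x)) := by
  simp [act]

theorem act_value (i : Fin (n + 1)) (h : Heap (Fin (n + 1))) :
    act i (value (dynkin n) (-qInt 2) h) = value (dynkin n) (-qInt 2) (h.cons i) := by
  obtain ⟨g, k, hn⟩ := exists_nf (dynkin n) h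
  have hi : Iso (dynkin n) (Quotient.out (cls (dynkin n) g)) g := Quotient.mk_out (s := isoSetoid _) g
  rw [hn.value_eq, act_single, hn.value_cons, (hi.cons i).value_eq]

/-- The representation of the Temperley-Lieb algebra on the free module on classes of heaps. -/
noncomputable def rep (n : ℕ) : TL n →ₐ[K] Module.End K (Class (dynkin n) →₀ K) :=
  RingQuot.liftAlgHom K ⟨FreeAlgebra.lift K act, by
    intro x y r
    cases r with
    | sq i =>
      rw [map_mul, map_smul, FreeAlgebra.lift_ι_apply]
      refine Finsupp.lhom_ext fun x r => ?_
      obtain ⟨g, hs, hi⟩ := cons_cons_self (G := dynkin n) i (Quotient.out x)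
      rw [Module.End.mul_apply, LinearMap.smul_apply, act_single, map_smul, act_value,
        hs.value_eq, hi.value_eq, pow_one, smul_comm]
    | braid i j h =>
      rw [map_mul, map_mul, FreeAlgebra.lift_ι_apply, FreeAlgebra.lift_ι_apply]
      refine Finsupp.lhom_ext fun x r => ?_
      obtain ⟨g, hs, hi⟩ := cons_cons_cons (G := dynkin n) (i := i) (j := j) h (Quotient.out x)
      rw [Module.End.mul_apply, Module.End.mul_apply, act_single, map_smul, map_smul, act_value,
        act_value, hs.value_eq, hi.value_eq, pow_zero, one_smul]
    | comm i j h =>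
      rw [map_mul, map_mul, FreeAlgebra.lift_ι_apply, FreeAlgebra.lift_ι_apply]
      by_cases hij : i = j
      · rw [hij]
      refine Finsupp.lhom_ext fun x r => ?_
      have hi := cons_comm (G := dynkin n) hij h (Quotient.out x)
      rw [Module.End.mul_apply, Module.End.mul_apply, act_single, act_single, map_smul, map_smul,
        act_value, act_value, hi.value_eq]⟩

theorem rep_E (i : Fin (n + 1)) : rep n (E i) = act i :=
  (RingQuot.liftAlgHom_mkAlgHom_apply K _ _ _).trans (FreeAlgebra.lift_ι_apply _ _)

theorem rep_word (w : List (Fin (n + 1))) :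
    rep n (word w) (value (dynkin n) (-qInt 2) (ofWord [])) =
      value (dynkin n) (-qInt 2) (ofWord w) := by
  induction w with
  | nil => rw [word_nil, map_one, Module.End.one_apply]
  | cons i w ih => rw [word_cons, map_mul, Module.End.mul_apply, ih, rep_E, act_value, ofWord_cons]

end Heap

open Heap in
/-- The elements given by reduced words are linearly independent. -/
theorem IsExpansion.unique {n : ℕ} {c c' : TL n →₀ K} {x : TL n} (h : IsExpansion c x)
    (h' : IsExpansion c' x) : c = c' := by
  let f : TL n →ₗ[K] (Class (dynkin n) →₀ K) :=
    (LinearMap.applyₗ (value (dynkin n) (-qInt 2) (ofWord []))).comp (rep n).toLinearMap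
  have hf : ∀ w : List (Fin (n + 1)), IsReduced w →
      f (word w) = Finsupp.single (cls (dynkin n) (ofWord w)) 1 := fun w hw =>
    (rep_word w).trans ((irred_ofWord hw).value_eq _)
  have hinj : ∀ v w : List (Fin (n + 1)),
      cls (dynkin n) (ofWord v) = cls (dynkin n) (ofWord w) → word v = word w := fun v w e => by
    rw [← eval_ofWord v, ← eval_ofWord w, (cls_eq_iff.1 e).eval_eq]
  have hc : ∀ d : TL n →₀ K, IsExpansion d x → ∀ w : List (Fin (n + 1)), IsReduced w →
      d (word w) = f x (cls (dynkin n) (ofWord w)) := by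
    intro d hd w hw
    rw [← hd.sum_eq, Finsupp.sum, map_sum, Finsupp.finsetSum_apply,
      Finset.sum_eq_single (word w)]
    · simp [hf w hw]
    · intro b hb hne
      obtain ⟨v, hv, rfl⟩ := hd.reduced b hb
      rw [map_smul, hf v hv, Finsupp.smul_apply, Finsupp.single_eq_of_ne, smul_zero]
      exact fun e => hne (hinj _ _ e.symm)
    · intro h0
      rw [Finsupp.notMem_support_iff.1 h0]
      simp
  ext b
  by_cases hb : ∃ w, IsReduced w ∧ word w = b
  · obtain ⟨w, hw, rfl⟩ := hb
    rw [hc c h w hw, hc c' h' w hw]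
  · have h0 : ∀ d : TL n →₀ K, IsExpansion d x → d b = 0 := fun d hd =>
      Finsupp.notMem_support_iff.1 fun hm => hb (hd.reduced b hm)
    rw [h0 c h, h0 c' h']

variable {n : ℕ}

theorem algHom_ext {A : Type*} [Semiring A] [Algebra K A] {f g : TL n →ₐ[K] A}
    (h : ∀ i, f (E i) = g (E i)) : f = g :=
  RingQuot.ringQuot_ext' _ _ _ (FreeAlgebra.hom_ext (funext h))

theorem incl_self (x : TL n) : incl le_rfl x = x := by
  have : incl le_rfl = AlgHom.id K (TL n) := algHom_ext fun i => by
    rw [incl_E]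
    rfl
  exact DFunLike.congr_fun this x

/-- The anti-automorphism reversing words, as a homomorphism to the opposite algebra. -/
noncomputable def revHom (n : ℕ) : TL n →ₐ[K] (TL n)ᵐᵒᵖ :=
  RingQuot.liftAlgHom K ⟨FreeAlgebra.lift K fun i => MulOpposite.op (E i), by
    intro x y r
    cases r with
    | sq i =>
      rw [map_mul, map_smul, FreeAlgebra.lift_ι_apply, ← MulOpposite.op_mul, E_sq,
        MulOpposite.op_smul]
    | braid i j h =>
      rw [map_mul, map_mul, FreeAlgebra.lift_ι_apply, FreeAlgebra.lift_ι_apply,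
        ← MulOpposite.op_mul, ← MulOpposite.op_mul, ← mul_assoc, E_braid _ _ h]
    | comm i j h =>
      rw [map_mul, map_mul, FreeAlgebra.lift_ι_apply, FreeAlgebra.lift_ι_apply,
        ← MulOpposite.op_mul, ← MulOpposite.op_mul, E_comm _ _ h]⟩

/-- The linear map reversing words. -/
noncomputable def rev (n : ℕ) : TL n →ₗ[K] TL n :=
  (MulOpposite.opLinearEquiv K).symm.toLinearMap ∘ₗ (revHom n).toLinearMap

theorem rev_E (i : Fin (n + 1)) : rev n (E i) = E i :=
  congrArg MulOpposite.unop ((RingQuot.liftAlgHom_mkAlgHom_apply K _ _ _).trans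
    (FreeAlgebra.lift_ι_apply _ _))

theorem rev_one : rev n 1 = 1 := congrArg MulOpposite.unop (map_one (revHom n))

theorem rev_mul (x y : TL n) : rev n (x * y) = rev n y * rev n x :=
  congrArg MulOpposite.unop (map_mul (revHom n) x y)

theorem rev_word (w : List (Fin (n + 1))) : rev n (word w) = word w.reverse := by
  induction w with
  | nil => exact rev_one
  | cons i w ih =>
    rw [word_cons, rev_mul, ih, rev_E, List.reverse_cons, word_append, word_cons, word_nil, mul_one]

theorem adjacent_theta (hn : 1 ≤ n) {i j : Fin (n + 1)} (h : Adjacent i.val j.val) :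
    Adjacent (theta i).val (theta j).val := by
  have key : ∀ i : Fin (n + 1), (i.val = 0 ∧ (theta i).val = 1) ∨ (i.val = 1 ∧ (theta i).val = 0) ∨
      (2 ≤ i.val ∧ (theta i).val = i.val) := by
    intro i
    have h1 : ((1 : Fin (n + 1)) : ℕ) = 1 := by
      rw [Fin.val_one', Nat.mod_eq_of_lt (by omega)]
    by_cases hi : i = 0
    · subst hi
      simp [theta]
      omega
    by_cases hi' : i = 1
    · subst hi'
      simp [theta]
      omega
    · right; right
      rw [theta, Equiv.swap_apply_of_ne_of_ne hi hi']
      refine ⟨?_, rfl⟩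
      rw [Fin.ext_iff, Fin.val_zero] at hi
      rw [Fin.ext_iff, h1] at hi'
      omega
  have h1 := key i
  have h2 := key j
  unfold Adjacent at *
  omega

theorem theta_theta (i : Fin (n + 1)) : theta (theta i) = i := Equiv.swap_apply_self _ _ _

theorem adjacent_theta_iff (hn : 1 ≤ n) (i j : Fin (n + 1)) :
    Adjacent (theta i).val (theta j).val ↔ Adjacent i.val j.val :=
  ⟨fun h => by simpa only [theta_theta] using adjacent_theta hn h, adjacent_theta hn⟩

/-- The automorphism exchanging `E_0` and `E_1`. -/
noncomputable def thetaHom (hn : 1 ≤ n) : TL n →ₐ[K] TL n :=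
  RingQuot.liftAlgHom K ⟨FreeAlgebra.lift K fun i => E (theta i), by
    intro x y r
    cases r with
    | sq i => rw [map_mul, map_smul, FreeAlgebra.lift_ι_apply, E_sq]
    | braid i j h =>
      rw [map_mul, map_mul, FreeAlgebra.lift_ι_apply, FreeAlgebra.lift_ι_apply,
        E_braid _ _ ((adjacent_theta_iff hn i j).2 h)]
    | comm i j h =>
      rw [map_mul, map_mul, FreeAlgebra.lift_ι_apply, FreeAlgebra.lift_ι_apply,
        E_comm _ _ (mt (adjacent_theta_iff hn i j).1 h)]⟩

theorem thetaHom_E (hn : 1 ≤ n) (i : Fin (n + 1)) : thetaHom hn (E i) = E (theta i) :=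
  (RingQuot.liftAlgHom_mkAlgHom_apply K _ _ _).trans (FreeAlgebra.lift_ι_apply _ _)

theorem thetaHom_word (hn : 1 ≤ n) (w : List (Fin (n + 1))) :
    thetaHom hn (word w) = word (w.map theta) := by
  simp [word, map_list_prod, Function.comp_def, thetaHom_E]

theorem word_map_theta_theta (w : List (Fin (n + 1))) : (w.map theta).map theta = w := by
  simp [Function.comp_def, theta_theta]

/-! ### Expansions in reduced words -/

theorem exists_reduced (w : List (Fin (n + 1))) :
    ∃ (v : List (Fin (n + 1))) (a : K), IsReduced v ∧ word w = a • word v := by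
  classical
  have hex : ∃ l : ℕ, ∃ (v : List (Fin (n + 1))) (a : K), v.length = l ∧ word w = a • word v :=
    ⟨_, w, 1, rfl, (one_smul _ _).symm⟩
  obtain ⟨v, a, hl, hw⟩ := Nat.find_spec hex
  refine ⟨v, a, fun v' b hv => ?_, hw⟩
  rw [hl]
  exact Nat.find_min' hex ⟨v', a * b, rfl, by rw [hw, hv, smul_smul]⟩

theorem mk_surjective : Function.Surjective (mk n) := RingQuot.mkAlgHom_surjective K (Rel n)

theorem span_word_eq_top : Submodule.span K (Set.range (word (n := n))) = ⊤ := by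
  rw [eq_top_iff]
  rintro x -
  obtain ⟨y, rfl⟩ := mk_surjective x
  have key : ∀ x ∈ Submodule.span K (Set.range (word (n := n))),
      ∀ y ∈ Submodule.span K (Set.range (word (n := n))),
        x * y ∈ Submodule.span K (Set.range (word (n := n))) := by
    intro x hx y hy
    have := Submodule.mul_mem_mul hx hy
    rw [Submodule.span_mul_span] at this
    refine Submodule.span_mono ?_ this
    rintro _ ⟨_, ⟨v, rfl⟩, _, ⟨w, rfl⟩, rfl⟩
    exact ⟨v ++ w, word_append v w⟩
  induction y using FreeAlgebra.induction with
  | grade0 r =>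
    rw [AlgHom.commutes, Algebra.algebraMap_eq_smul_one]
    exact Submodule.smul_mem _ _ (Submodule.subset_span ⟨[], rfl⟩)
  | grade1 i => exact Submodule.subset_span ⟨[i], by rw [word_cons, word_nil, mul_one]; rfl⟩
  | mul a b ha hb => rw [map_mul]; exact key _ ha _ hb
  | add a b ha hb => rw [map_add]; exact Submodule.add_mem _ ha hb

theorem exists_isExpansion (x : TL n) : ∃ c, IsExpansion c x := by
  have hx : x ∈ Submodule.span K {b : TL n | ∃ w, IsReduced w ∧ word w = b} := by
    have h1 : x ∈ Submodule.span K (Set.range (word (n := n))) := by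
      rw [span_word_eq_top]
      exact Submodule.mem_top
    refine Submodule.span_le.2 ?_ h1
    rintro _ ⟨w, rfl⟩
    obtain ⟨v, a, hv, hw⟩ := exists_reduced w
    rw [SetLike.mem_coe, hw]
    exact Submodule.smul_mem _ _ (Submodule.subset_span ⟨v, hv, rfl⟩)
  obtain ⟨c, hc, hs⟩ := Submodule.mem_span_set.1 hx
  exact ⟨c, fun b hb => hc hb, hs⟩

/-- A linear involution that permutes the elements given by reduced words and fixes `x` preserves
the coefficients of `x`. -/
theorem IsExpansion.apply_eq {c : TL n →₀ K} {x : TL n} (hc : IsExpansion c x)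
    (f : TL n →ₗ[K] TL n) (hf : ∀ y, f (f y) = y)
    (hr : ∀ w, IsReduced w → ∃ v, IsReduced v ∧ word v = f (word w)) (hx : f x = x) (b : TL n) :
    c (f b) = c b := by
  let e : TL n ≃ TL n := ⟨f, f, hf, hf⟩
  have h1 : IsExpansion (c.equivMapDomain e) x := by
    constructor
    · intro b hb
      have hb' : f b ∈ c.support := by simpa [e] using hb
      obtain ⟨w, hw, hwb⟩ := hc.reduced _ hb'
      obtain ⟨v, hv, hvw⟩ := hr w hw
      exact ⟨v, hv, by rw [hvw, hwb, hf]⟩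
    · rw [Finsupp.sum_equivMapDomain]
      have := congrArg f hc.sum_eq
      rw [Finsupp.sum, map_sum, hx] at this
      simpa [Finsupp.sum, e] using this
  have h2 := DFunLike.congr_fun (h1.unique hc) b
  exact h2

theorem IsReduced.of_linearMap {w v : List (Fin (n + 1))} (hw : IsReduced w) (f : TL n →ₗ[K] TL n)
    (hf : ∀ u, ∃ u' : List (Fin (n + 1)), u'.length = u.length ∧ f (word u) = word u')
    (hv : f (word v) = word w) (hl : v.length = w.length) : IsReduced v := by
  intro u a hu
  obtain ⟨u', hl', hu'⟩ := hf u
  have := hw u' a (by rw [← hv, hu, map_smul, hu'])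
  omega

theorem IsReduced.reverse {w : List (Fin (n + 1))} (hw : IsReduced w) : IsReduced w.reverse :=
  hw.of_linearMap (rev n) (fun u => ⟨u.reverse, List.length_reverse, rev_word u⟩)
    (by rw [rev_word, List.reverse_reverse]) List.length_reverse

theorem IsReduced.map_theta (hn : 1 ≤ n) {w : List (Fin (n + 1))} (hw : IsReduced w) :
    IsReduced (w.map theta) :=
  hw.of_linearMap (thetaHom hn).toLinearMap
    (fun u => ⟨u.map theta, List.length_map _, thetaHom_word hn u⟩)
    ((thetaHom_word hn _).trans (by rw [word_map_theta_theta])) (List.length_map _)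

theorem linearMap_ext {M : Type*} [AddCommMonoid M] [Module K M] {f g : TL n →ₗ[K] M}
    (h : ∀ w, f (word w) = g (word w)) : f = g :=
  LinearMap.ext_on_range span_word_eq_top h

theorem rev_rev (x : TL n) : rev n (rev n x) = x := by
  have : rev n ∘ₗ rev n = LinearMap.id := linearMap_ext fun w => by
    simp [rev_word]
  exact DFunLike.congr_fun this x

theorem thetaHom_thetaHom (hn : 1 ≤ n) (x : TL n) : thetaHom hn (thetaHom hn x) = x := by
  have : (thetaHom hn).comp (thetaHom hn) = AlgHom.id K _ := algHom_ext fun i => by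
    simp [thetaHom_E, theta_theta]
  exact DFunLike.congr_fun this x

/-! ### Symmetries of the Jones-Wenzl projections -/

/-- An element killed by all generators from the right acts on the left by scalars. -/
theorem exists_mul_eq_smul (x : TL n) : ∃ a : K,
    (∀ y : TL n, (∀ i, y * E i = 0) → y * x = a • y) ∧
      ∀ y : TL n, (∀ i, E i * y = 0) → x * y = a • y := by
  have hx : x ∈ Submodule.span K (Set.range (word (n := n))) := by
    rw [span_word_eq_top]
    exact Submodule.mem_top
  induction hx using Submodule.span_induction with
  | mem x hx =>
    obtain ⟨w, rfl⟩ := hx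
    rcases w.eq_nil_or_concat' with rfl | ⟨w, i, rfl⟩
    · exact ⟨1, by simp [word_nil], by simp [word_nil]⟩
    · refine ⟨0, fun y hy => ?_, fun y hy => ?_⟩
      · rcases w with _ | ⟨j, w⟩
        · simp [word, hy]
        · rw [List.cons_append, word_cons, ← mul_assoc, hy, zero_mul, zero_smul]
      · rw [word_append, word_cons, word_nil, mul_one, mul_assoc, hy, mul_zero, zero_smul]
  | zero => exact ⟨0, by simp, by simp⟩
  | add x x' _ _ h h' =>
    obtain ⟨a, h1, h2⟩ := h
    obtain ⟨b, h3, h4⟩ := h'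
    exact ⟨a + b, fun y hy => by rw [mul_add, h1 y hy, h3 y hy, add_smul],
      fun y hy => by rw [add_mul, h2 y hy, h4 y hy, add_smul]⟩
  | smul r x _ h =>
    obtain ⟨a, h1, h2⟩ := h
    exact ⟨r * a, fun y hy => by rw [mul_smul_comm, h1 y hy, smul_smul],
      fun y hy => by rw [smul_mul_assoc, h2 y hy, smul_smul]⟩

/-- Idempotents that are killed by all generators from both sides coincide. -/
theorem eq_of_kill {x y : TL n} (hx : x ≠ 0) (hy : y ≠ 0) (hxx : x * x = x) (hyy : y * y = y)
    (hx' : ∀ i, E i * x = 0 ∧ x * E i = 0) (hy' : ∀ i, E i * y = 0 ∧ y * E i = 0) : x = y := by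
  obtain ⟨a, h1, h2⟩ := exists_mul_eq_smul x
  obtain ⟨b, h3, h4⟩ := exists_mul_eq_smul y
  have key : ∀ {z : TL n} {r : K}, z ≠ 0 → z * z = z → z * z = r • z → r = 1 := by
    intro z r hz hzz hr
    rw [hzz, ← sub_eq_zero, ← one_smul K z, smul_smul, ← sub_smul] at hr
    by_contra hne
    refine hz ?_
    rw [← one_smul K z, ← inv_mul_cancel₀ (sub_ne_zero.2 (Ne.symm hne)), ← smul_smul]
    rw [mul_one] at hr
    rw [hr, smul_zero]
  have ha := key hx hxx (h1 x fun i => (hx' i).2)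
  have hb := key hy hyy (h3 y fun i => (hy' i).2)
  have e1 := h3 x fun i => (hx' i).2
  have e2 := h2 y fun i => (hy' i).1
  rw [ha, one_smul] at e2
  rw [hb, one_smul] at e1
  exact e1.symm.trans e2

theorem IsJonesWenzl.mul_self {Q : ∀ n : ℕ, TL n} (hQ : IsJonesWenzl Q) (n : ℕ) :
    Q n * Q n = Q n := by
  have := (hQ.absorb n n le_rfl).1
  rwa [incl_self] at this

theorem IsJonesWenzl.rev_eq {Q : ∀ n : ℕ, TL n} (hQ : IsJonesWenzl Q) (n : ℕ) :
    rev n (Q n) = Q n := by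
  refine eq_of_kill (fun h => hQ.ne_zero n ?_) (hQ.ne_zero n) ?_ (hQ.mul_self n) (fun i => ?_)
    (hQ.kill n)
  · rw [← rev_rev (Q n), h, map_zero]
  · rw [← rev_mul, hQ.mul_self]
  · rw [← rev_E i, ← rev_mul, ← rev_mul, (hQ.kill n i).1, (hQ.kill n i).2, map_zero]
    exact ⟨rfl, rfl⟩

theorem IsJonesWenzl.thetaHom_eq {Q : ∀ n : ℕ, TL n} (hQ : IsJonesWenzl Q) (hn : 1 ≤ n) :
    thetaHom hn (Q n) = Q n := by
  refine eq_of_kill (fun h => hQ.ne_zero n ?_) (hQ.ne_zero n) ?_ (hQ.mul_self n) (fun i => ?_)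
    (hQ.kill n)
  · rw [← thetaHom_thetaHom hn (Q n), h, map_zero]
  · rw [← map_mul, hQ.mul_self]
  · rw [← theta_theta i, ← thetaHom_E hn, ← map_mul, ← map_mul, (hQ.kill n _).1, (hQ.kill n _).2,
      map_zero]
    exact ⟨rfl, rfl⟩

/-! ### Strands of a stack of generators -/

theorem connected_equivalence (w : List (Fin (n + 1))) : Equivalence (Connected w) :=
  Relation.EqvGen.is_equivalence _

theorem StackArc.level_le {w : List (Fin (n + 1))} {x y : ℕ × Fin (n + 1)} (h : StackArc w x y) :
    x.1 ≤ w.length ∧ y.1 ≤ w.length := by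
  cases h with
  | cup k s a b hs ha hb =>
    obtain ⟨hk, -⟩ := List.getElem?_eq_some_iff.1 hs
    exact ⟨hk.le, hk.le⟩
  | cap k s a b hs ha hb =>
    obtain ⟨hk, -⟩ := List.getElem?_eq_some_iff.1 hs
    exact ⟨hk, hk⟩
  | vertical k s a hs ha hb =>
    obtain ⟨hk, -⟩ := List.getElem?_eq_some_iff.1 hs
    exact ⟨hk.le, hk⟩

theorem Connected.eq_or_level_le {w : List (Fin (n + 1))} {x y : ℕ × Fin (n + 1)}
    (h : Connected w x y) : x = y ∨ (x.1 ≤ w.length ∧ y.1 ≤ w.length) := by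
  induction h with
  | rel x y h => exact Or.inr h.level_le
  | refl x => exact Or.inl rfl
  | symm x y _ ih => exact ih.imp Eq.symm And.symm
  | trans x y z _ _ h1 h2 =>
    rcases h1 with rfl | h1
    · exact h2
    · rcases h2 with rfl | h2
      · exact Or.inr h1
      · exact Or.inr ⟨h1.1, h2.2⟩

theorem Connected.append {w : List (Fin (n + 1))} {x y : ℕ × Fin (n + 1)} (h : Connected w x y)
    (s : Fin (n + 1)) : Connected (w ++ [s]) x y := by
  have key : ∀ (k : ℕ) (t : Fin (n + 1)), w[k]? = some t → (w ++ [s])[k]? = some t := by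
    intro k t hk
    obtain ⟨h1, -⟩ := List.getElem?_eq_some_iff.1 hk
    rw [List.getElem?_append_left h1, hk]
  refine Relation.EqvGen.mono (fun x y h => ?_) _ _ h
  cases h with
  | cup k t a b hs ha hb => exact .cup k t a b (key k t hs) ha hb
  | cap k t a b hs ha hb => exact .cap k t a b (key k t hs) ha hb
  | vertical k t a hs ha hb => exact .vertical k t a (key k t hs) ha hb

/-- Contraction of the layer between the levels `l` and `l + 1` to the level `l`, except for the
cap joining `a` and `b`, which is contracted to a point. -/
def contract (l : ℕ) (a b : Fin (n + 1)) (x : ℕ × Fin (n + 1)) : ℕ × Fin (n + 1) :=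
  if x.1 = l + 1 then if x.2 = a ∨ x.2 = b then (l + 1, a) else (l, x.2) else x

theorem contract_of_le {l : ℕ} (a b : Fin (n + 1)) {x : ℕ × Fin (n + 1)} (h : x.1 ≤ l) :
    contract l a b x = x := if_neg (by omega)

/-- The relation obtained from `R` by joining the classes of `x` and `y`. -/
def Merge {α : Type*} (R : α → α → Prop) (x y u v : α) : Prop :=
  R u v ∨ (R u x ∧ R v y) ∨ (R u y ∧ R v x)

theorem merge_equivalence {α : Type*} {R : α → α → Prop} (h : Equivalence R) (x y : α) :
    Equivalence (Merge R x y) where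
  refl u := Or.inl (h.refl u)
  symm := by
    rintro u v (h1 | h1 | h1)
    · exact Or.inl (h.symm h1)
    · exact Or.inr (Or.inr h1.symm)
    · exact Or.inr (Or.inl h1.symm)
  trans := by
    rintro u v z (h1 | h1 | h1) (h2 | h2 | h2)
    · exact Or.inl (h.trans h1 h2)
    · exact Or.inr (Or.inl ⟨h.trans h1 h2.1, h2.2⟩)
    · exact Or.inr (Or.inr ⟨h.trans h1 h2.1, h2.2⟩)
    · exact Or.inr (Or.inl ⟨h1.1, h.trans (h.symm h2) h1.2⟩)
    · exact Or.inr (Or.inl ⟨h1.1, h2.2⟩)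
    · exact Or.inl (h.trans h1.1 (h.symm h2.2))
    · exact Or.inr (Or.inr ⟨h1.1, h.trans (h.symm h2) h1.2⟩)
    · exact Or.inl (h.trans h1.1 (h.symm h2.2))
    · exact Or.inr (Or.inr ⟨h1.1, h2.2⟩)

theorem connected_append_iff {w : List (Fin (n + 1))} {s a b : Fin (n + 1)}
    (ha : a.val = s.val - 1) (hb : b.val = s.val - 1 + 1) (x y : ℕ × Fin (n + 1)) :
    Connected (w ++ [s]) x y ↔ Merge (Connected w) (w.length, a) (w.length, b)
      (contract w.length a b x) (contract w.length a b y) := by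
  have hw := connected_equivalence w
  have hw' := connected_equivalence (w ++ [s])
  have hm := merge_equivalence hw (w.length, a) (w.length, b)
  have hlast : (w ++ [s])[w.length]? = some s := by simp
  constructor
  · intro h
    induction h with
    | refl x => exact hm.refl _
    | symm x y _ ih => exact hm.symm ih
    | trans x y z _ _ h1 h2 => exact hm.trans h1 h2
    | rel x y h =>
      have hk : ∀ (k : ℕ) (t : Fin (n + 1)), (w ++ [s])[k]? = some t →
          w[k]? = some t ∨ (k = w.length ∧ t = s) := by
        intro k t hk
        rcases lt_trichotomy k w.length with h1 | h1 | h1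
        · rw [List.getElem?_append_left h1] at hk
          exact Or.inl hk
        · subst h1
          exact Or.inr ⟨rfl, by simpa using hk.symm⟩
        · rw [List.getElem?_eq_none (by simp; omega)] at hk
          simp at hk
      have old : ∀ x y, StackArc w x y → Merge (Connected w) (w.length, a) (w.length, b)
          (contract w.length a b x) (contract w.length a b y) := by
        intro x y h
        rw [contract_of_le _ _ h.level_le.1, contract_of_le _ _ h.level_le.2]
        exact Or.inl (.rel _ _ h)
      cases h with
      | cup k t c d hs hc hd =>
        rcases hk k t hs with hs | ⟨rfl, rfl⟩
        · exact old _ _ (.cup k t c d hs hc hd)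
        · obtain rfl : c = a := Fin.ext (hc.trans ha.symm)
          obtain rfl : d = b := Fin.ext (hd.trans hb.symm)
          rw [contract_of_le (x := (w.length, c)) _ _ le_rfl,
            contract_of_le (x := (w.length, d)) _ _ le_rfl]
          exact Or.inr (Or.inl ⟨hw.refl _, hw.refl _⟩)
      | cap k t c d hs hc hd =>
        rcases hk k t hs with hs | ⟨rfl, rfl⟩
        · exact old _ _ (.cap k t c d hs hc hd)
        · obtain rfl : c = a := Fin.ext (hc.trans ha.symm)
          obtain rfl : d = b := Fin.ext (hd.trans hb.symm)
          simpa [contract] using hm.refl _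
      | vertical k t c hs hc hd =>
        rcases hk k t hs with hs | ⟨rfl, rfl⟩
        · exact old _ _ (.vertical k t c hs hc hd)
        · have h1 : c ≠ a := fun e => hc (e ▸ ha)
          have h2 : c ≠ b := fun e => hd (e ▸ hb)
          simpa [contract, h1, h2] using hm.refl _
  · have hcontr : ∀ x, Connected (w ++ [s]) x (contract w.length a b x) := by
      rintro ⟨k, c⟩
      unfold contract
      dsimp only
      split_ifs with h1 h2
      · subst h1
        rcases h2 with rfl | rfl
        · exact hw'.refl _
        · exact hw'.symm (.rel _ _ (.cap _ s a c hlast ha hb))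
      · subst h1
        rw [not_or] at h2
        refine hw'.symm (.rel _ _ (.vertical _ s c hlast ?_ ?_))
        · exact fun e => h2.1 (Fin.ext (e.trans ha.symm))
        · exact fun e => h2.2 (Fin.ext (e.trans hb.symm))
      · exact hw'.refl _
    have hAB : Connected (w ++ [s]) (w.length, a) (w.length, b) :=
      .rel _ _ (.cup _ s a b hlast ha hb)
    rintro (h | ⟨h1, h2⟩ | ⟨h1, h2⟩)
    · exact hw'.trans (hcontr x) (hw'.trans (h.append s) (hw'.symm (hcontr y)))
    · exact hw'.trans (hcontr x) (hw'.trans (h1.append s) (hw'.trans hAB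
        (hw'.trans (hw'.symm (h2.append s)) (hw'.symm (hcontr y)))))
    · exact hw'.trans (hcontr x) (hw'.trans (h1.append s) (hw'.trans (hw'.symm hAB)
        (hw'.trans (hw'.symm (h2.append s)) (hw'.symm (hcontr y)))))

/-- Joining two arcs of a perfect matching and adding a new arc gives a perfect matching. -/
theorem existsUnique_of_merge {ι : Type*} {S T : ι → ι → Prop} (hS : Equivalence S) {u v : ι}
    (huv : u ≠ v) (hmatch : ∀ p, ∃! p', p ≠ p' ∧ S p p')
    (hTu : ∀ p p', (p = u ∨ p = v) → (T p p' ↔ p' = u ∨ p' = v))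
    (hTu' : ∀ p p', (p' = u ∨ p' = v) → (T p p' ↔ p = u ∨ p = v))
    (hT : ∀ p p', p ≠ u → p ≠ v → p' ≠ u → p' ≠ v → (T p p' ↔ Merge S u v p p')) (p : ι) :
    ∃! p', p ≠ p' ∧ T p p' := by
  choose μ h1 h2 using hmatch
  have hμ : ∀ p, p ≠ μ p ∧ S p (μ p) := fun p => h1 p
  have hμ' : ∀ p p', p ≠ p' → S p p' → p' = μ p := fun p p' h h' => h2 p p' ⟨h, h'⟩
  have hinv : ∀ p, μ (μ p) = p := fun p => (hμ' _ _ (hμ p).1.symm (hS.symm (hμ p).2)).symm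
  by_cases hpu : p = u
  · exact ⟨v, by grind, by grind⟩
  by_cases hpv : p = v
  · exact ⟨u, by grind, by grind⟩
  have hSiff : ∀ p p', S p p' ↔ p' = p ∨ p' = μ p := by
    intro p p'
    constructor
    · intro h
      by_cases e : p' = p
      · exact Or.inl e
      · exact Or.inr (hμ' _ _ (Ne.symm e) h)
    · rintro (rfl | rfl)
      exacts [hS.refl _, (hμ p).2]
  have hT' : ∀ p', p' ≠ u → p' ≠ v → (T p p' ↔ (p' = p ∨ p' = μ p) ∨
      (u = μ p ∧ v = μ p') ∨ (v = μ p ∧ u = μ p')) := by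
    intro p' hu hv
    rw [hT p p' hpu hpv hu hv, Merge]
    simp only [hSiff]
    grind
  by_cases hu : μ p = u
  · refine ⟨μ v, ?_, ?_⟩ <;> grind
  by_cases hv : μ p = v
  · refine ⟨μ u, ?_, ?_⟩ <;> grind
  · refine ⟨μ p, ?_, ?_⟩ <;> grind

theorem connected_nil_iff (x y : ℕ × Fin (n + 1)) : Connected [] x y ↔ x = y := by
  constructor
  · intro h
    induction h with
    | rel x y h => cases h <;> simp_all
    | refl x => rfl
    | symm x y _ ih => exact ih.symm
    | trans x y z _ _ h1 h2 => exact h1.trans h2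
  · rintro rfl
    exact .refl _

/-- The strands of a stack give a perfect matching of the marked points. -/
theorem stack_existsUnique (hn : 1 ≤ n) (w : List (Fin (n + 1))) (p : Point n) :
    ∃! p', (stack w).joined p p' := by
  induction w using List.reverseRecOn generalizing p with
  | nil =>
    refine ⟨p.swap, ⟨?_, ?_⟩, ?_⟩
    · cases p <;> simp
    · rw [connected_nil_iff]
      cases p <;> rfl
    · rintro p' ⟨h1, h2⟩
      rw [connected_nil_iff] at h2
      rcases p with i | i <;> rcases p' with j | j <;> simp_all [node]
  | append_singleton w s ih =>
    obtain ⟨a, ha⟩ : ∃ a : Fin (n + 1), a.val = s.val - 1 := ⟨⟨s.val - 1, by omega⟩, rfl⟩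
    obtain ⟨b, hb⟩ : ∃ b : Fin (n + 1), b.val = s.val - 1 + 1 := ⟨⟨s.val - 1 + 1, by omega⟩, rfl⟩
    have hab : a ≠ b := fun e => by
      rw [Fin.ext_iff] at e
      omega
    have hw := connected_equivalence w
    have h1 : ∀ p : Point n, p = Sum.inr a ∨ p = Sum.inr b →
        contract w.length a b (node (w ++ [s]) p) = (w.length + 1, a) := by
      rintro p (rfl | rfl) <;> simp [node, contract]
    have h2 : ∀ p : Point n, p ≠ Sum.inr a → p ≠ Sum.inr b →
        contract w.length a b (node (w ++ [s]) p) = node w p := by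
      rintro (i | i) hi hi'
      · simp [node, contract]
      · simp only [ne_eq, Sum.inr.injEq] at hi hi'
        simp [node, contract, hi, hi']
    have hlevel : ∀ p : Point n, (node w p).1 ≤ w.length := by
      rintro (i | i) <;> simp [node]
    have h3 : ∀ p : Point n, ¬ Connected w (w.length + 1, a) (node w p) := by
      intro p h
      have h5 := hlevel p
      rcases h.eq_or_level_le with h4 | h4
      · rw [← h4] at h5
        simp at h5
      · simp at h4
    have h4 : ∀ p : Point n, ¬ Connected w (node w p) (w.length + 1, a) :=
      fun p h => h3 p (hw.symm h)
    refine existsUnique_of_merge (S := fun p p' => Connected w (node w p) (node w p'))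
      (T := fun p p' => Connected (w ++ [s]) (node (w ++ [s]) p) (node (w ++ [s]) p'))
      (u := Sum.inr a) (v := Sum.inr b) ⟨fun p => hw.refl _, hw.symm, hw.trans⟩
      (by simpa using hab) ih ?_ ?_ ?_ p
    · intro p p' hp
      by_cases hp' : p' = Sum.inr a ∨ p' = Sum.inr b
      · simpa [connected_append_iff ha hb, h1 p hp, h1 p' hp', hp'] using
          (merge_equivalence hw _ _).refl _
      · have hp'' := not_or.1 hp'
        have h5 := h3 p'
        have h6 := h3 (Sum.inr a)
        have h7 := h3 (Sum.inr b)
        simp only [node] at h6 h7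
        simp [connected_append_iff ha hb, h1 p hp, h2 p' hp''.1 hp''.2, Merge, h5, h6, h7, hp'']
    · intro p p' hp'
      by_cases hp : p = Sum.inr a ∨ p = Sum.inr b
      · simpa [connected_append_iff ha hb, h1 p hp, h1 p' hp', hp] using
          (merge_equivalence hw _ _).refl _
      · have hp'' := not_or.1 hp
        have h5 := h4 p
        have h6 := h3 (Sum.inr a)
        have h7 := h3 (Sum.inr b)
        simp only [node] at h6 h7
        simp [connected_append_iff ha hb, h1 p' hp', h2 p hp''.1 hp''.2, Merge, h5, h6, h7, hp'']
    · intro p p' hpu hpv hpu' hpv'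
      rw [connected_append_iff ha hb, h2 p hpu hpv, h2 p' hpu' hpv']
      rfl

/-! ### Turning diagrams upside down -/

namespace PreDiagram

/-- The reflection of a diagram in a horizontal line. -/
def mirror (D : PreDiagram n) : PreDiagram n where
  joined p p' := D.joined p.swap p'.swap
  dotted p := D.dotted p.swap

theorem mirror_mirror (D : PreDiagram n) : D.mirror.mirror = D := by
  ext <;> simp [mirror]

theorem numDots_mirror (D : PreDiagram n) : D.mirror.numDots = D.numDots := by
  have hinj : Function.Injective (Sym2.map (Sum.swap : Point n → Point n)) :=
    Sym2.map.injective (Equiv.sumComm _ _).injective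
  rw [numDots, numDots, ← Set.ncard_image_of_injective _ hinj]
  congr 1
  ext a
  constructor
  · rintro ⟨_, ⟨p, p', rfl, h1, h2⟩, rfl⟩
    exact ⟨p.swap, p'.swap, rfl, h1, h2⟩
  · rintro ⟨p, p', rfl, h1, h2⟩
    exact ⟨s(p.swap, p'.swap), ⟨p.swap, p'.swap, rfl, by simpa [mirror] using h1,
      by simpa [mirror] using h2⟩, by simp⟩

theorem normalize_of_even {D : PreDiagram n} (h : Even D.numDots) : D.normalize = D := by
  ext p <;> simp [normalize, h, Nat.not_odd_iff_even.2 h]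

theorem normalize_dotted_of_odd {D : PreDiagram n} (h : Odd D.numDots) (p : Point n) :
    D.normalize.dotted p ↔ p = Sum.inr 0 ∨ D.joined p (Sum.inr 0) := by
  simp [normalize, h, Nat.not_even_iff_odd.2 h]

theorem numDots_normalize_of_odd {D : PreDiagram n} (hs : ∀ p p', D.joined p p' → D.joined p' p)
    (hm : ∀ p, ∃! p', D.joined p p') (h : Odd D.numDots) : D.normalize.numDots = 1 := by
  rw [numDots, Set.ncard_eq_one]
  obtain ⟨t, ht, htu⟩ := hm (Sum.inr 0)
  refine ⟨s(Sum.inr 0, t), ?_⟩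
  ext a
  simp only [Set.mem_ofPred_eq, Set.mem_singleton_iff, normalize_dotted_of_odd h]
  constructor
  · rintro ⟨p, p', rfl, h1, rfl | h2⟩
    · rw [htu p' h1]
    · have h3 := (hm p).unique h1 h2
      rw [h3, htu p (hs _ _ h2), Sym2.eq_swap]
  · rintro rfl
    exact ⟨_, _, rfl, ht, Or.inl rfl⟩

theorem normalize_mirror_normalize {D : PreDiagram n}
    (hs : ∀ p p', D.joined p p' → D.joined p' p) (hm : ∀ p, ∃! p', D.joined p p') :
    D.normalize.mirror.normalize = D.mirror.normalize := by
  rcases Nat.even_or_odd D.numDots with h | h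
  · rw [normalize_of_even h]
  · have h1 : Odd D.mirror.numDots := by rwa [numDots_mirror]
    have h2 : Odd D.normalize.mirror.numDots := by
      rw [numDots_mirror, numDots_normalize_of_odd hs hm h]
      exact odd_one
    ext p p'
    · rfl
    · rw [normalize_dotted_of_odd h1, normalize_dotted_of_odd h2]
      rfl

namespace IsDiagram

variable {D : PreDiagram n}

theorem mirror_existsUnique (h : D.IsDiagram) (p : Point n) : ∃! p', D.mirror.joined p p' := by
  obtain ⟨t, ht, hu⟩ := h.matching p.swap
  refine ⟨t.swap, by simpa [mirror] using ht, fun y hy => ?_⟩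
  rw [← hu _ hy, Sum.swap_swap]

theorem normalize_eq (h : D.IsDiagram) : D.normalize = D := by
  rcases h.one_or_even with h1 | h1
  · have h0 := h.one_case h1
    ext p
    · rfl
    · rw [normalize_dotted_of_odd (h1 ▸ odd_one)]
      constructor
      · rintro (rfl | hp)
        · exact h0
        · exact (h.dotted_iff _ _ hp).2 h0
      · intro hp
        obtain ⟨t, ht⟩ := (h.matching (Sum.inr 0)).exists
        obtain ⟨u, hu⟩ := (h.matching p).exists
        rw [numDots, Set.ncard_eq_one] at h1
        obtain ⟨a, ha⟩ := h1
        have e1 : s(Sum.inr 0, t) = a := by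
          rw [← Set.mem_singleton_iff, ← ha]
          exact ⟨_, _, rfl, ht, h0⟩
        have e2 : s(p, u) = a := by
          rw [← Set.mem_singleton_iff, ← ha]
          exact ⟨_, _, rfl, hu, hp⟩
        rw [← e1, Sym2.eq_iff] at e2
        rcases e2 with e2 | e2
        · exact Or.inl e2.1
        · exact Or.inr (e2.2 ▸ hu)
  · exact normalize_of_even h1

theorem flip_flip (h : D.IsDiagram) : D.flip.flip = D := by
  change D.mirror.normalize.mirror.normalize = D
  rw [normalize_mirror_normalize (D := D.mirror) (fun p p' => h.symm _ _) h.mirror_existsUnique, mirror_mirror,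
    h.normalize_eq]

theorem leftmostVertical_mirror (h : D.IsDiagram) {i j : Fin (n + 1)}
    (hv : D.LeftmostVertical i j) : D.mirror.LeftmostVertical j i := by
  obtain ⟨hij, hl⟩ := hv
  refine ⟨h.symm _ _ hij, ?_⟩
  rintro ⟨b, a, hb, hab⟩
  have hab' : D.joined (Sum.inl a) (Sum.inr b) := h.symm _ _ hab
  rcases lt_trichotomy a i with h1 | h1 | h1
  · exact hl ⟨a, b, h1, hab'⟩
  · subst h1
    have := (h.matching _).unique hab' hij
    rw [Sum.inr.injEq] at this
    omega
  · refine h.planar _ _ _ _ hij hab' ⟨?_, ?_, ?_⟩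
    all_goals simp only [pos]; omega

theorem exposed_mirror (h : D.IsDiagram) {p : Point n} (hp : D.Exposed p) :
    D.mirror.Exposed p.swap := by
  rcases hp with ⟨i, j, h1, h2⟩ | ⟨i, j, h1, h2⟩ | ⟨i, j, h1, h2⟩
  · refine Or.inr (Or.inl ⟨i, j, h1, ?_⟩)
    rcases h2 with rfl | rfl <;> simp
  · refine Or.inl ⟨i, j, h1, ?_⟩
    rcases h2 with rfl | rfl <;> simp
  · refine Or.inr (Or.inr ⟨j, i, h.leftmostVertical_mirror h1, ?_⟩)
    rcases h2 with rfl | rfl <;> simp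

theorem pos_swap (p : Point n) : pos p.swap = 2 * n + 1 - pos p := by
  rcases p with i | i
  · rfl
  · simp only [pos, Sum.swap_inr]
    omega

theorem mirror_planar (h : D.IsDiagram) (p p' r r' : Point n) (h1 : D.mirror.joined p p')
    (h2 : D.mirror.joined r r') : ¬ (pos p < pos r ∧ pos r < pos p' ∧ pos p' < pos r') := by
  have h3 := h.planar _ _ _ _ (h.symm _ _ h2) (h.symm _ _ h1)
  have hle : ∀ p : Point n, pos p ≤ 2 * n + 1 := by
    rintro (i | i) <;> simp only [pos] <;> omega
  simp only [pos_swap] at h3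
  have := hle p
  have := hle p'
  have := hle r
  have := hle r'
  omega

/-- The upside-down diagram is a diagram. -/
theorem flip (h : D.IsDiagram) : D.flip.IsDiagram := by
  change D.mirror.normalize.IsDiagram
  have hs : ∀ p p', D.mirror.joined p p' → D.mirror.joined p' p := fun p p' => h.symm _ _
  have hvert : (∀ i, D.mirror.joined (Sum.inl i) (Sum.inr i)) → ∀ p, ¬ D.dotted p :=
    fun h1 => h.vertical_case fun i => h.symm _ _ (h1 i)
  rcases h.one_or_even with h1 | h1
  · have ho : Odd D.mirror.numDots := by
      rw [numDots_mirror, h1]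
      exact odd_one
    have hnum := numDots_normalize_of_odd hs h.mirror_existsUnique ho
    refine ⟨fun p => h.irrefl _, hs, h.mirror_existsUnique, h.mirror_planar, ?_, Or.inl hnum, ?_, ?_,
      ?_⟩
    · intro p p' hp
      rw [normalize_dotted_of_odd ho, normalize_dotted_of_odd ho]
      have key : ∀ p p', D.mirror.joined p p' →
          (p = Sum.inr 0 ∨ D.mirror.joined p (Sum.inr 0)) →
          (p' = Sum.inr 0 ∨ D.mirror.joined p' (Sum.inr 0)) := by
        rintro p p' hp (rfl | h2)
        · exact Or.inr (hs _ _ hp)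
        · exact Or.inl ((h.mirror_existsUnique p).unique hp h2)
      exact ⟨key p p' hp, key p' p (hs _ _ hp)⟩
    · rw [hnum]
      intro h2
      exact absurd h2 Nat.not_even_one
    · intro _
      rw [normalize_dotted_of_odd ho]
      exact Or.inl rfl
    · intro h2
      exact absurd (h.one_case h1) (hvert h2 _)
  · have he : Even D.mirror.numDots := by rwa [numDots_mirror]
    rw [normalize_of_even he]
    refine ⟨fun p => h.irrefl _, hs, h.mirror_existsUnique, h.mirror_planar,
      fun p p' hp => h.dotted_iff _ _ hp, Or.inr he, ?_, ?_, fun h2 p => hvert h2 _⟩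
    · intro _ p hp
      simpa using h.exposed_mirror (h.even_case h1 _ hp)
    · intro h2
      rw [h2] at he
      exact absurd he Nat.not_even_one

end IsDiagram

end PreDiagram

theorem getElem?_reverse_eq_some {w : List (Fin (n + 1))} {k : ℕ} {s : Fin (n + 1)}
    (h : w.reverse[k]? = some s) : k < w.length ∧ w[w.length - 1 - k]? = some s := by
  obtain ⟨h1, -⟩ := List.getElem?_eq_some_iff.1 h
  rw [List.length_reverse] at h1
  rw [List.getElem?_reverse h1] at h
  exact ⟨h1, h⟩

/-- Reversal of the levels of a stack of height `l`. -/
def revNode (l : ℕ) (x : ℕ × Fin (n + 1)) : ℕ × Fin (n + 1) := (l - x.1, x.2)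

theorem Connected.of_reverse {w : List (Fin (n + 1))} {x y : ℕ × Fin (n + 1)}
    (h : Connected w.reverse x y) : Connected w (revNode w.length x) (revNode w.length y) := by
  have hw := connected_equivalence w
  induction h with
  | refl x => exact hw.refl _
  | symm x y _ ih => exact hw.symm ih
  | trans x y z _ _ h1 h2 => exact hw.trans h1 h2
  | rel x y h =>
    cases h with
    | cup k s a b hs ha hb =>
      obtain ⟨hk, hs⟩ := getElem?_reverse_eq_some hs
      have := StackArc.cap _ s a b hs ha hb
      rw [show w.length - 1 - k + 1 = w.length - k by omega] at this
      exact .rel _ _ this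
    | cap k s a b hs ha hb =>
      obtain ⟨hk, hs⟩ := getElem?_reverse_eq_some hs
      have := StackArc.cup _ s a b hs ha hb
      rw [show w.length - 1 - k = w.length - (k + 1) by omega] at this
      exact .rel _ _ this
    | vertical k s a hs ha hb =>
      obtain ⟨hk, hs⟩ := getElem?_reverse_eq_some hs
      have := StackArc.vertical _ s a hs ha hb
      rw [show w.length - 1 - k + 1 = w.length - k by omega,
        show w.length - 1 - k = w.length - (k + 1) by omega] at this
      exact hw.symm (.rel _ _ this)

theorem revNode_node_reverse (w : List (Fin (n + 1))) (p : Point n) :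
    revNode w.length (node w.reverse p) = node w p.swap := by
  rcases p with i | i <;> simp [revNode, node]

theorem stack_reverse (w : List (Fin (n + 1))) : stack w.reverse = (stack w).mirror := by
  have h1 : ∀ (w : List (Fin (n + 1))) (p p' : Point n), (stack w.reverse).joined p p' →
      (stack w).joined p.swap p'.swap := by
    rintro w p p' ⟨hne, h⟩
    have := h.of_reverse
    rw [revNode_node_reverse, revNode_node_reverse] at this
    exact ⟨fun e => hne ((Equiv.sumComm _ _).injective e), this⟩
  have h2 : ∀ (w : List (Fin (n + 1))) (p : Point n), (stack w.reverse).dotted p →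
      (stack w).dotted p.swap := by
    rintro w p ⟨k, hk, h⟩
    obtain ⟨hlt, hk⟩ := getElem?_reverse_eq_some hk
    refine ⟨_, hk, ?_⟩
    rw [show w.length - 1 - k + 1 = w.length - k by omega,
      show w.length - 1 - k = w.length - (k + 1) by omega]
    rcases h with h | h
    · right
      have := h.of_reverse
      rwa [revNode_node_reverse] at this
    · left
      have := h.of_reverse
      rwa [revNode_node_reverse] at this
  ext p p'
  · refine ⟨h1 w p p', fun h => ?_⟩
    have := h1 w.reverse p.swap p'.swap (by rwa [List.reverse_reverse])
    simpa using this
  · refine ⟨h2 w p, fun h => ?_⟩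
    have := h2 w.reverse p.swap (by rwa [List.reverse_reverse])
    simpa using this

/-- The diagram of the reversed word is the upside-down diagram. -/
theorem diagram_reverse (hn : 1 ≤ n) (w : List (Fin (n + 1))) :
    diagram w.reverse = (diagram w).flip := by
  change (stack w.reverse).normalize = (stack w).normalize.mirror.normalize
  rw [PreDiagram.normalize_mirror_normalize _ (stack_existsUnique hn w), stack_reverse]
  exact fun p p' h => ⟨h.1.symm, h.2.symm⟩

open Classical in
theorem diagramCoef_flip (hn : 1 ≤ n) {c : TL n →₀ K} (hc : ∀ b, c (rev n b) = c b)
    {D : PreDiagram n} (hD : D.IsDiagram) : diagramCoef c D = diagramCoef c D.flip := by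
  have key : ∀ D : PreDiagram n, ∀ b ∈ c.support,
      (∃ w, IsReduced w ∧ word w = b ∧ diagram w = D) →
      rev n b ∈ c.support ∧ ∃ w, IsReduced w ∧ word w = rev n b ∧ diagram w = D.flip := by
    rintro D b hb ⟨w, hw, rfl, rfl⟩
    refine ⟨?_, w.reverse, hw.reverse, (rev_word w).symm, diagram_reverse hn w⟩
    rw [Finsupp.mem_support_iff] at *
    rwa [hc]
  unfold diagramCoef
  refine Finset.sum_nbij' (rev n) (rev n) ?_ ?_ (fun b _ => rev_rev b) (fun b _ => rev_rev b)
    (fun b _ => (hc b).symm)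
  · intro b hb
    rw [Finset.mem_filter] at *
    exact key D b hb.1 hb.2
  · intro b hb
    rw [Finset.mem_filter] at *
    simpa only [hD.flip_flip] using key D.flip b hb.1 hb.2

end TLD

theorem mainTheorem11 (Q : ∀ n : ℕ, TLD.TL n) (hQ : TLD.IsJonesWenzl Q) (n : ℕ) :
    ∃ c : TLD.TL n →₀ TLD.K,
      -- `Q n` has one and only one expansion in reduced words
      TLD.IsExpansion c (Q n) ∧
      (∀ c' : TLD.TL n →₀ TLD.K, TLD.IsExpansion c' (Q n) → c' = c) ∧
      -- reversal of words
      (∀ w : List (Fin (n + 1)), TLD.IsReduced w →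
        TLD.IsReduced w.reverse ∧ c (TLD.word w) = c (TLD.word w.reverse)) ∧
      -- turning diagrams upside down
      (1 ≤ n →
        (∀ w : List (Fin (n + 1)), TLD.IsReduced w →
          TLD.diagram w.reverse = (TLD.diagram w).flip) ∧
        (∀ D : TLD.PreDiagram n, D.IsDiagram →
          D.flip.IsDiagram ∧ TLD.diagramCoef c D = TLD.diagramCoef c D.flip)) ∧
      -- exchanging `E_0` and `E_1`
      (1 ≤ n →
        ∀ w : List (Fin (n + 1)),
          (TLD.IsReduced w → TLD.IsReduced (w.map TLD.theta)) ∧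
            c (TLD.word w) = c (TLD.word (w.map TLD.theta))) := by
  obtain ⟨c, hc⟩ := TLD.exists_isExpansion (Q n)
  have hrev : ∀ b, c (TLD.rev n b) = c b := hc.apply_eq (TLD.rev n) TLD.rev_rev
    (fun w hw => ⟨_, hw.reverse, (TLD.rev_word w).symm⟩) (hQ.rev_eq n)
  refine ⟨c, hc, fun c' hc' => hc'.unique hc, fun w hw => ⟨hw.reverse, ?_⟩, fun hn =>
    ⟨fun w _ => TLD.diagram_reverse hn w, fun D hD => ⟨hD.flip, TLD.diagramCoef_flip hn hrev hD⟩⟩,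
    fun hn w => ⟨fun hw => hw.map_theta hn, ?_⟩⟩
  · rw [← TLD.rev_word, hrev]
  · rw [← TLD.thetaHom_word hn]
    exact (hc.apply_eq (TLD.thetaHom hn).toLinearMap (TLD.thetaHom_thetaHom hn)
      (fun w hw => ⟨_, hw.map_theta hn, (TLD.thetaHom_word hn w).symm⟩)
      (hQ.thetaHom_eq hn) (TLD.word w)).symm
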